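/- \textbf{Setting.} Let $s>2$, let $n=\lfloor s\rfloor$, and let $(m_i)_{i\ge 1}$ be a sequence with $m_i\in\{n,n+1\}$ and $\frac{n}{n+1}\prod_{j=1}^i m_j^{-1}\le s^{-i}\le \frac{n+1}{n}\prod_{j=1}^i m_j^{-1}$ for all $i$. Let $F\subset\mathbb R$ be the attractor of $f_0(x)=x/s$, $f_1(x)=x/s+(s-1)/s$; every point of $F$ is $\sum_{i\ge1}a_i\frac{s-1}{s^{i}}$ for a unique string $a\in\{0,1\}^{\mathbb N}$. The wormhole levels of order $k\ge 1$ are the numbers in $$J_k=\Big\{\sum_{j=1}^k n_j\prod_{h=1}^j m_h^{-1} : 0\le n_j<m_j,\ n_k\neq 0\Big\}.$$ The Laakso space $L$ is the topological quotient of $F\times[0,1]$ in which $(x_1,t)$ and $(x_2,t)$ are identified whenever, for some $k$, $t\in J_k$ and the strings of $x_1,x_2$ differ exactly in the $k$-th digit. Let $\pi:F\times[0,1]\to L$ be the projection and $h:L\to[0,1]$ the height, $h(\pi(x_1,t))=t$. The distance of $x,y\in L$ is $$d(x,y)=\inf\{\mathcal H^1(\Gamma) : \Gamma\subset F\times[0,1],\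 \pi(\Gamma)\text{ is the image of a continuous path in }L\text{ from }x\text{ to }y\},$$ where $\mathcal H^1$ is the Hausdorff measure for the Euclidean metric. Order $N$ is \emph{required} to connect $x$ to $y$ if the strings of any representatives of $x$ and of $y$ differ in the $N$-th digit. A \emph{minimal height interval} for $x,y$ is an interval $[a,b]\subseteq[0,1]$ of least length among the closed intervals that contain $h(x)$ and $h(y)$ and meet $J_N$ for every $N$ that is required to connect $x$ to $y$. A \emph{segment path} is a continuous path $p:[0,1]\to L$ together with countably many non-overlapping closed intervals $T_j$ (possibly single points) covering $[0,1]$ and points $c_j\in F$ such that on each $T_j$ one has $p(t)=\pi(c_j,h(p(t)))$ with $h\circ p$ monotone; its lift is $\Gamma=\bigcup_j\{(c_j,h(p(t))):t\in T_j\}$ and its length is $\mathcal H^1(\Gamma)$. It is a \emph{geodesic} if its length equals $d(p(0),p(1))$. A segment path from $x$ to $y$ is \emph{associated to} $[a,b]$ if either $h(x)\le h(y)$ and it descends along one vertical segment from $x$ to height $a$, then ascends monotonically to height $b$, then descends along one vertical segment to $y$; or $h(y)\le h(x)$ and it ascends along one vertical segment from $x$ to height $b$, then descends monotonically to height $a$,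 then ascends along one vertical segment to $y$. The first and last pieces may be trivial, so the path has at most two inversions, located at the heights $a$ and $b$. \textbf{Theorem.} Let $x,y\in L$. There is a minimal height interval for $x$ and $y$. For every minimal height interval $[a,b]$ for $x$ and $y$, there is a path from $x$ to $y$ associated to $[a,b]$, every such path is a geodesic, and $$d(x,y)=2b-2a-|h(y)-h(x)|.$$ -/

import Mathlib

open Set MeasureTheory
open scoped MeasureTheory ENNReal unitInterval

noncomputable section

namespace Laakso

/-- The parameters of a Laakso space of dimension `Q = 1 + log_s 2 ∈ (1, 2)`: a real number
`s > 2` and a sequence `m` of integers, each equal to `n` or `n + 1` where `n ≤ s < n + 1`, whose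
partial products are comparable with the powers of `s`.  All indices start at `0`: `m i` is the
number usually written `m_{i+1}`. -/
structure Params where
  s : ℝ
  two_lt_s : 2 < s
  m : ℕ → ℕ
  m_mem : ∀ i, m i = ⌊s⌋₊ ∨ m i = ⌊s⌋₊ + 1
  m_lower : ∀ i, (⌊s⌋₊ : ℝ) / ((⌊s⌋₊ : ℝ) + 1) * ∏ j ∈ Finset.range i, (m j : ℝ)⁻¹ ≤ 1 / s ^ i
  m_upper : ∀ i, 1 / s ^ i ≤ ((⌊s⌋₊ : ℝ) + 1) / (⌊s⌋₊ : ℝ) * ∏ j ∈ Finset.range i, (m j : ℝ)⁻¹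

/-- The first map of the iterated function system. -/
def ifs₀ (P : Params) (x : ℝ) : ℝ := x / P.s

/-- The second map of the iterated function system. -/
def ifs₁ (P : Params) (x : ℝ) : ℝ := x / P.s + (P.s - 1) / P.s

/-- The summand contributed by the digit `e` in position `i`. -/
def digitTerm (P : Params) (i : ℕ) (e : Bool) : ℝ := if e then (P.s - 1) / P.s ^ (i + 1) else 0

/-- The point of the real line with the infinite string of digits `a` (`true` is `1`, `false` is
`0`), that is, the limit of `f_{a 0} ∘ f_{a 1} ∘ ⋯ ∘ f_{a n}` as `n → ∞`. -/
def point (P : Params) (a : ℕ → Bool) : ℝ := ∑' i, digitTerm P i (a i)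

/-- The Cantor-like fractal, given through its coordinates by strings.  It is the attractor of the
iterated function system `ifs₀`, `ifs₁`; see `isCompact_fractal`, `fractal_nonempty`,
`ifs_fractal`. -/
def fractal (P : Params) : Set ℝ := range (point P)

theorem digitTerm_bound (P : Params) (i : ℕ) (e : Bool) :
    ‖digitTerm P i e‖ ≤ (P.s - 1) / P.s * (P.s⁻¹) ^ i := by
  have hs := P.two_lt_s
  have h0 : 0 ≤ (P.s - 1) / P.s * (P.s⁻¹) ^ i := by
    have : 0 ≤ P.s - 1 := by linarith
    positivity
  have h1 : (P.s - 1) / P.s ^ (i + 1) = (P.s - 1) / P.s * (P.s⁻¹) ^ i := by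
    rw [inv_pow, ← div_eq_mul_inv, div_div, pow_succ']
  unfold digitTerm
  split_ifs
  · rw [h1, Real.norm_of_nonneg h0]
  · simpa using h0

theorem summable_bound (P : Params) : Summable fun i : ℕ => (P.s - 1) / P.s * (P.s⁻¹) ^ i := by
  have hs := P.two_lt_s
  exact (summable_geometric_of_lt_one (by positivity)
    (inv_lt_one_of_one_lt₀ (by linarith))).mul_left _

theorem summable_digitTerm (P : Params) (a : ℕ → Bool) :
    Summable fun i => digitTerm P i (a i) :=
  Summable.of_norm_bounded (summable_bound P) fun i => digitTerm_bound P i (a i)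

theorem continuous_point (P : Params) : Continuous (point P) :=
  continuous_tsum (fun i => (continuous_of_discreteTopology (f := digitTerm P i)).comp
    (continuous_apply i)) (summable_bound P) fun i a => digitTerm_bound P i (a i)

theorem isCompact_fractal (P : Params) : IsCompact (fractal P) :=
  isCompact_range (continuous_point P)

theorem fractal_nonempty (P : Params) : (fractal P).Nonempty := range_nonempty _

theorem point_eq (P : Params) (a : ℕ → Bool) :
    point P a = digitTerm P 0 (a 0) + point P (fun i => a (i + 1)) / P.s := by
  have hs := P.two_lt_s
  unfold point
  rw [(summable_digitTerm P a).tsum_eq_zero_add, ← tsum_div_const]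
  congr 2
  funext i
  have : P.s ≠ 0 := by linarith
  unfold digitTerm
  split_ifs
  · rw [div_div, ← pow_succ]
  · simp

theorem ifs_fractal (P : Params) : ifs₀ P '' fractal P ∪ ifs₁ P '' fractal P = fractal P := by
  ext z
  constructor
  · rintro (⟨_, ⟨a, rfl⟩, rfl⟩ | ⟨_, ⟨a, rfl⟩, rfl⟩)
    · refine ⟨fun i => Nat.casesOn i false a, ?_⟩
      rw [point_eq]
      simp [digitTerm, ifs₀]
    · refine ⟨fun i => Nat.casesOn i true a, ?_⟩
      rw [point_eq]
      simp [digitTerm, ifs₁, add_comm]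
  · rintro ⟨a, rfl⟩
    rw [point_eq]
    cases h : a 0
    · exact Or.inl ⟨_, ⟨fun i => a (i + 1), rfl⟩, by simp [digitTerm, ifs₀]⟩
    · exact Or.inr ⟨_, ⟨fun i => a (i + 1), rfl⟩, by simp [digitTerm, ifs₁, add_comm]⟩

/-- `levels P k` is the (finite) set of the wormhole levels of order `k + 1`. -/
def levels (P : Params) (k : ℕ) : Set ℝ :=
  {w | ∃ n : ℕ → ℕ, (∀ j ≤ k, n j < P.m j) ∧ n k ≠ 0 ∧
    w = ∑ j ∈ Finset.range (k + 1), (n j : ℝ) * ∏ i ∈ Finset.range (j + 1), (P.m i : ℝ)⁻¹}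

/-- The switching function, which changes the digit in position `k` and no other. -/
def switch (k : ℕ) (a : ℕ → Bool) : ℕ → Bool := Function.update a k (!(a k))

/-- The product of the fractal and the unit interval. -/
abbrev Cover (P : Params) : Type := fractal P × I

/-- The identifications: two points at the same height, which is a wormhole level of order `k + 1`,
are identified if their strings differ exactly in the digit in position `k` (so that their first
coordinates differ by `(s - 1) / s ^ (k + 1)` and lie in sibling cells of order `k + 1`). -/
def Wormhole (P : Params) (p q : Cover P) : Prop :=
  p.2 = q.2 ∧ ∃ k : ℕ, (p.2 : ℝ) ∈ levels P k ∧
    ∃ a : ℕ → Bool, (p.1 : ℝ) = point P a ∧ (q.1 : ℝ) = point P (switch k a)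

/-- The Laakso space: the quotient by the equivalence relation generated by the identifications,
with the quotient topology. -/
def Space (P : Params) : Type := Quot (Wormhole P)

instance (P : Params) : TopologicalSpace (Space P) :=
  inferInstanceAs (TopologicalSpace (Quot (Wormhole P)))

/-- The identification map. -/
def proj (P : Params) (z : Cover P) : Space P := Quot.mk _ z

/-- The height function. -/
def height {P : Params} : Space P → I := Quot.lift (fun z => z.2) fun _ _ h => h.1

/-- The product of the fractal and the unit interval as a subset of the Euclidean plane. -/
def toPlane {P : Params} (z : Cover P) : EuclideanSpace ℝ (Fin 2) := !₂[(z.1 : ℝ), (z.2 : ℝ)]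

/-- One-dimensional Hausdorff measure of a subset of the product, for the Euclidean metric. -/
def hausdorffLength {P : Params} (Γ : Set (Cover P)) : ℝ≥0∞ := μH[1] (toPlane '' Γ)

/-- The distance of the Laakso space: the infimum of the one-dimensional Hausdorff measures of the
sets `Γ` whose projection is (the image of) a path joining the two points. -/
def laaksoDist {P : Params} (x y : Space P) : ℝ≥0∞ :=
  ⨅ (Γ : Set (Cover P)) (_ : ∃ p : Path x y, range p = proj P '' Γ), hausdorffLength Γ

/-- Jumps through wormholes of order `k + 1` are required to connect `x` to `y`: whatever
representatives of `x` and `y` are chosen, their strings differ in position `k`. -/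
def Required {P : Params} (x y : Space P) (k : ℕ) : Prop :=
  ∀ (p q : Cover P) (a b : ℕ → Bool), proj P p = x → proj P q = y →
    (p.1 : ℝ) = point P a → (q.1 : ℝ) = point P b → a k ≠ b k

/-- `[a, b] ⊆ [0, 1]` contains the heights of `x` and `y` and meets the wormhole levels of every
order that is required to connect `x` to `y`. -/
def IsAdmissible {P : Params} (x y : Space P) (a b : ℝ) : Prop :=
  0 ≤ a ∧ a ≤ b ∧ b ≤ 1 ∧ (height x : ℝ) ∈ Icc a b ∧ (height y : ℝ) ∈ Icc a b ∧
    ∀ k, Required x y k → (Icc a b ∩ levels P k).Nonempty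

/-- `[a, b]` is a minimal height interval for `x` and `y`. -/
def IsMinimalInterval {P : Params} (x y : Space P) (a b : ℝ) : Prop :=
  IsAdmissible x y a b ∧ ∀ a' b', IsAdmissible x y a' b' → b - a ≤ b' - a'

/-- A path from `x` to `y` which is the image of countably many closed vertical segments: the time
interval is the union of countably many non-overlapping closed intervals `[left j, right j]`
(possibly reduced to points), and during `[left j, right j]` the path is the projection of a
segment in the column `col j`, run through monotonically. -/
structure SegmentPath {P : Params} (x y : Space P) where
  path : Path x y
  col : ℕ → fractal P
  left : ℕ → I
  right : ℕ → I
  left_le_right : ∀ j, left j ≤ right j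
  cover : ∀ t : I, ∃ j, t ∈ Icc (left j) (right j)
  nonoverlapping : ∀ i j, i ≠ j → Disjoint (Ioo (left i) (right i)) (Ioo (left j) (right j))
  path_eq : ∀ j, ∀ t ∈ Icc (left j) (right j), path t = proj P (col j, height (path t))
  monotone_or_antitone : ∀ j, MonotoneOn (fun t => height (path t)) (Icc (left j) (right j)) ∨
    AntitoneOn (fun t => height (path t)) (Icc (left j) (right j))

/-- The lift of the path: the union of its vertical segments. -/
def SegmentPath.lift {P : Params} {x y : Space P} (γ : SegmentPath x y) : Set (Cover P) :=
  {z | ∃ j, ∃ t ∈ Icc (γ.left j) (γ.right j), z = (γ.col j, height (γ.path t))}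

/-- The length of a path with its lift. -/
def SegmentPath.length {P : Params} {x y : Space P} (γ : SegmentPath x y) : ℝ≥0∞ :=
  hausdorffLength γ.lift

/-- A geodesic: a path whose length is the least possible, that is, the distance of its ends. -/
def SegmentPath.IsGeodesic {P : Params} {x y : Space P} (γ : SegmentPath x y) : Prop :=
  γ.length = laaksoDist x y

/-- The path is associated to the interval `[a, b]`.  If `height x ≤ height y`, it goes down from
`x` to height `a` along one vertical segment, then upward from height `a` to height `b`, then down
from height `b` to `y` along one vertical segment.  If `height y ≤ height x`, it goes up from `x`
to height `b` along one vertical segment, then downward to height `a`, then up to `y` along one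
vertical segment.  The first and the last leg may be trivial; the only inversions are the at most
two at the heights `a` and `b`, between the legs. -/
def SegmentPath.IsAssociated {P : Params} {x y : Space P} (γ : SegmentPath x y) (a b : ℝ) : Prop :=
  ∃ t₁ t₂ : I, t₁ ≤ t₂ ∧
    (∃ c : fractal P, ∀ t ∈ Icc 0 t₁, γ.path t = proj P (c, height (γ.path t))) ∧
    (∃ c : fractal P, ∀ t ∈ Icc t₂ 1, γ.path t = proj P (c, height (γ.path t))) ∧
    ((height x ≤ height y ∧
        AntitoneOn (fun t => height (γ.path t)) (Icc 0 t₁) ∧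
        (height (γ.path t₁) : ℝ) = a ∧
        MonotoneOn (fun t => height (γ.path t)) (Icc t₁ t₂) ∧
        (height (γ.path t₂) : ℝ) = b ∧
        AntitoneOn (fun t => height (γ.path t)) (Icc t₂ 1)) ∨
      (height y ≤ height x ∧
        MonotoneOn (fun t => height (γ.path t)) (Icc 0 t₁) ∧
        (height (γ.path t₁) : ℝ) = b ∧
        AntitoneOn (fun t => height (γ.path t)) (Icc t₁ t₂) ∧
        (height (γ.path t₂) : ℝ) = a ∧
        MonotoneOn (fun t => height (γ.path t)) (Icc t₂ 1)))

end Laakso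

end

namespace Laakso

/-! Let `lo ≤ hi` be the two heights. The claimed distance is `(hi - lo) + 2 (lo - a) + 2 (b - hi)`:
heights between the points count once, the rest of `[a, b]` twice.

Lower bound. Let `Γ` project onto a path. If all points of `Γ` at a height `t ≤ lo` share their
digit in position `k`, and so do those at a height `u ≥ hi`, then every excursion of the path
outside `[t, u]` returns with the digit it left with. By connectedness of the time interval, a
required digit can then change only at a level inside `[t, u]` (`not_disjoint_levels_of_agrees`).
Positions beyond some `K` have levels in every interval of length `(b - a) / 2`, so minimality
forces `b - a ≤ u - t` as soon as `Γ` agrees in the first `K` digits at both heights. Hence `Γ`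
meets two cylinders at every height in two gaps of total length at least `(b - a) - (hi - lo)`, and
these heights count twice (`volume_add_two_mul_volume_le`).

Upper bound. Representatives can be chosen to differ only in required digits (`exists_strings`).
Each such digit is switched on the middle leg, at a level of its own index. Level sets of distinct
indices are disjoint, so at most one digit jumps at any time, and that jump is invisible in the
quotient: the path is continuous even with infinitely many switches (`continuous_proj_switching`).
On a monotone leg the lift is no longer than the change of height (`hausdorffLength_liftOn_le`). -/

variable {P : Params}

/-! ### Strings as coordinates on the fractal -/

/-- The point of the fractal with a given string. -/
noncomputable def pt (P : Params) (a : ℕ → Bool) : fractal P := ⟨point P a, a, rfl⟩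

theorem continuous_pt (P : Params) : Continuous (pt P) :=
  (continuous_point P).subtype_mk _

theorem exists_pt (c : fractal P) : ∃ a, pt P a = c := by
  obtain ⟨_, a, rfl⟩ := c
  exact ⟨a, rfl⟩

theorem point_nonneg (a : ℕ → Bool) : 0 ≤ point P a := by
  have hs := P.two_lt_s
  refine tsum_nonneg fun i => ?_
  unfold digitTerm
  split_ifs
  · have : 0 ≤ P.s - 1 := by linarith
    positivity
  · exact le_rfl

theorem point_le_one (a : ℕ → Bool) : point P a ≤ 1 := by
  have hs := P.two_lt_s
  have h1 : ∑' i : ℕ, (P.s - 1) / P.s * (P.s⁻¹) ^ i = 1 := by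
    rw [tsum_mul_left, tsum_geometric_of_lt_one (by positivity)
      (inv_lt_one_of_one_lt₀ (by linarith))]
    have : P.s - 1 ≠ 0 := by linarith
    field_simp
  rw [← h1]
  exact (summable_digitTerm P a).tsum_le_tsum
    (fun i => (le_abs_self _).trans (digitTerm_bound P i (a i))) (summable_bound P)

/-- As `s > 2`, the first-level cells lie in the disjoint intervals `[0, 1 / s]` and `[(s - 1) / s,
1]`. -/
theorem point_head_eq {a b : ℕ → Bool} (h : point P a = point P b) : a 0 = b 0 := by
  have hs := P.two_lt_s
  have key : ∀ a b : ℕ → Bool, a 0 = false → b 0 = true → point P a ≠ point P b := by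
    intro a b ha hb
    rw [point_eq P a, point_eq P b]
    have h1 := point_le_one (P := P) (fun i => a (i + 1))
    have h2 := point_nonneg (P := P) (fun i => b (i + 1))
    have h3 : point P (fun i => a (i + 1)) / P.s ≤ 1 / P.s := by gcongr
    have h4 : 0 ≤ point P (fun i => b (i + 1)) / P.s := by positivity
    have h5 : 1 / P.s < (P.s - 1) / P.s := by gcongr; linarith
    simp only [digitTerm, ha, hb]
    norm_num
    intro h
    linarith
  cases ha : a 0 <;> cases hb : b 0
  · rfl
  · exact absurd h (key a b ha hb)
  · exact absurd h.symm (key b a hb ha)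
  · rfl

theorem point_injective (P : Params) : Function.Injective (point P) := by
  have hs : P.s ≠ 0 := by linarith [P.two_lt_s]
  intro a b h
  have key : ∀ i : ℕ, ∀ a b : ℕ → Bool, point P a = point P b → a i = b i := by
    intro i
    induction i with
    | zero => exact fun a b h => point_head_eq h
    | succ i ih =>
      intro a b h
      refine ih (fun i => a (i + 1)) (fun i => b (i + 1)) ?_
      have h0 := point_head_eq h
      rw [point_eq P a, point_eq P b, h0] at h
      simpa [hs] using h
  exact funext fun i => key i a b h

theorem pt_injective (P : Params) : Function.Injective (pt P) := fun _ _ h =>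
  point_injective P (congrArg Subtype.val h)

/-! ### Arithmetic of the wormhole levels -/

/-- The denominator of the wormhole levels of order less than `k + 1`. -/
def den (P : Params) (k : ℕ) : ℕ := ∏ i ∈ Finset.range k, P.m i

theorem two_le_m (P : Params) (i : ℕ) : 2 ≤ P.m i := by
  have h : 2 ≤ ⌊P.s⌋₊ := Nat.le_floor (by exact_mod_cast P.two_lt_s.le)
  rcases P.m_mem i with h' | h' <;> omega

theorem den_succ (P : Params) (k : ℕ) : den P (k + 1) = den P k * P.m k :=
  Finset.prod_range_succ _ _

theorem two_pow_le_den (P : Params) (k : ℕ) : 2 ^ k ≤ den P k := by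
  induction k with
  | zero => simp [den]
  | succ k ih =>
    rw [den_succ, pow_succ]
    exact Nat.mul_le_mul ih (two_le_m P k)

theorem den_pos (P : Params) (k : ℕ) : 0 < den P k :=
  (pow_pos two_pos k).trans_le (two_pow_le_den P k)

theorem den_dvd_den (P : Params) {j k : ℕ} (h : j ≤ k) : den P j ∣ den P k :=
  Finset.prod_dvd_prod_of_subset _ _ _ (by simpa using h)

theorem prod_inv_eq (P : Params) (k : ℕ) :
    ∏ i ∈ Finset.range k, (P.m i : ℝ)⁻¹ = (den P k : ℝ)⁻¹ := by
  simp [den]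

theorem two_div_den_le (P : Params) (k : ℕ) : 2 / (den P k : ℝ) ≤ 2 * (1 / 2 : ℝ) ^ k := by
  have h : (2 : ℝ) ^ k ≤ den P k := by exact_mod_cast two_pow_le_den P k
  rw [div_pow, one_pow, mul_one_div]
  gcongr

theorem exists_two_div_den_lt (P : Params) {ε : ℝ} (hε : 0 < ε) :
    ∃ K, ∀ k ≥ K, 2 / (den P k : ℝ) < ε := by
  obtain ⟨K, hK⟩ := exists_pow_lt_of_lt_one (half_pos hε) (by norm_num : (1 / 2 : ℝ) < 1)
  refine ⟨K, fun k hk => (two_div_den_le P k).trans_lt ?_⟩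
  have := pow_le_pow_of_le_one (by norm_num : (0 : ℝ) ≤ 1 / 2) (by norm_num) hk
  linarith

theorem exists_numerator {k : ℕ} {n : ℕ → ℕ} (hn : ∀ j < k, n j < P.m j) :
    ∃ q < den P k, ∑ j ∈ Finset.range k, (n j : ℝ) * ∏ i ∈ Finset.range (j + 1), (P.m i : ℝ)⁻¹ =
      q / den P k := by
  induction k with
  | zero => exact ⟨0, den_pos P 0, by simp⟩
  | succ k ih =>
    obtain ⟨q, hq, h⟩ := ih fun j hj => hn j (by omega)
    have h1 : (den P k : ℝ) ≠ 0 := by exact_mod_cast (den_pos P k).ne'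
    have h2 : (P.m k : ℝ) ≠ 0 := by exact_mod_cast (by have := two_le_m P k; omega : P.m k ≠ 0)
    refine ⟨q * P.m k + n k, ?_, ?_⟩
    · rw [den_succ]
      have := hn k (by omega)
      nlinarith
    · rw [Finset.sum_range_succ, h, prod_inv_eq, den_succ]
      push_cast
      field_simp

theorem exists_digits {k q : ℕ} (hq : q < den P k) :
    ∃ n : ℕ → ℕ, (∀ j < k, n j < P.m j) ∧
      ∑ j ∈ Finset.range k, (n j : ℝ) * ∏ i ∈ Finset.range (j + 1), (P.m i : ℝ)⁻¹ =
        q / den P k := by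
  induction k generalizing q with
  | zero =>
    refine ⟨0, by simp, ?_⟩
    have : q = 0 := by simpa [den] using hq
    simp [this]
  | succ k ih =>
    have hm : 0 < P.m k := by have := two_le_m P k; omega
    rw [den_succ] at hq
    obtain ⟨n, hn, h⟩ := ih (Nat.div_lt_of_lt_mul (by rwa [mul_comm]) : q / P.m k < den P k)
    have h1 : (den P k : ℝ) ≠ 0 := by exact_mod_cast (den_pos P k).ne'
    have h2 : (P.m k : ℝ) ≠ 0 := by exact_mod_cast hm.ne'
    refine ⟨Function.update n k (q % P.m k), ?_, ?_⟩
    · intro j hj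
      rcases (Nat.lt_succ_iff_lt_or_eq.1 hj) with hj' | rfl
      · rw [Function.update_of_ne hj'.ne]
        exact hn j hj'
      · rw [Function.update_self]
        exact Nat.mod_lt _ hm
    · rw [Finset.sum_range_succ, Function.update_self, prod_inv_eq, den_succ]
      have h3 : ∀ j ∈ Finset.range k, ((Function.update n k (q % P.m k) j : ℕ) : ℝ) *
          ∏ i ∈ Finset.range (j + 1), (P.m i : ℝ)⁻¹ =
          (n j : ℝ) * ∏ i ∈ Finset.range (j + 1), (P.m i : ℝ)⁻¹ := by
        intro j hj
        rw [Function.update_of_ne (Finset.mem_range.1 hj).ne]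
      rw [Finset.sum_congr rfl h3, h]
      have h4 : (q : ℝ) = P.m k * (q / P.m k : ℕ) + (q % P.m k : ℕ) := by
        exact_mod_cast (Nat.div_add_mod q (P.m k)).symm
      rw [Nat.cast_mul]
      field_simp
      linarith

/-- Only the last mixed-radix digit matters; the earlier ones merge into one numerator. Divisibility
and density are read off from this form. -/
theorem mem_levels_iff {k : ℕ} {w : ℝ} : w ∈ levels P k ↔
    ∃ q < den P k, ∃ r < P.m k, r ≠ 0 ∧ w = q / den P k + r / den P (k + 1) := by
  constructor
  · rintro ⟨n, hn, hk, rfl⟩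
    obtain ⟨q, hq, h⟩ := exists_numerator (P := P) (k := k) (n := n) fun j hj => hn j hj.le
    refine ⟨q, hq, n k, hn k le_rfl, hk, ?_⟩
    rw [Finset.sum_range_succ, h, prod_inv_eq, div_eq_mul_inv (n k : ℝ)]
  · rintro ⟨q, hq, r, hr, hr0, rfl⟩
    obtain ⟨n, hn, h⟩ := exists_digits hq
    refine ⟨Function.update n k r, ?_, by simpa using hr0, ?_⟩
    · intro j hj
      rcases hj.lt_or_eq with hj' | rfl
      · rw [Function.update_of_ne hj'.ne]
        exact hn j hj'
      · rwa [Function.update_self]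
    · rw [Finset.sum_range_succ, Function.update_self, prod_inv_eq, ← h,
        div_eq_mul_inv (r : ℝ)]
      congr 1
      refine Finset.sum_congr rfl fun j hj => ?_
      rw [Function.update_of_ne (Finset.mem_range.1 hj).ne]

theorem finite_levels (P : Params) (k : ℕ) : (levels P k).Finite := by
  refine (((finite_Iio (den P k)).prod (finite_Iio (P.m k))).image
    fun z : ℕ × ℕ => (z.1 : ℝ) / den P k + (z.2 : ℝ) / den P (k + 1)).subset ?_
  intro w hw
  obtain ⟨q, hq, r, hr, -, rfl⟩ := mem_levels_iff.1 hw
  exact ⟨(q, r), ⟨hq, hr⟩, rfl⟩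

/-- In units of `1 / den P (l + 1)`, a level of index `k < l` is a multiple of `P.m l`, whereas one
of index `l` leaves a nonzero remainder. -/
theorem not_lt_of_mem_levels {k l : ℕ} {w : ℝ} (hk : w ∈ levels P k) (hl : w ∈ levels P l) :
    ¬ k < l := by
  intro hkl
  obtain ⟨q, -, r, -, -, rfl⟩ := mem_levels_iff.1 hk
  obtain ⟨q', -, r', hr', hr0, h⟩ := mem_levels_iff.1 hl
  obtain ⟨d, hd⟩ := den_dvd_den P (Nat.succ_le_of_lt hkl)
  have h0 : (den P k : ℝ) ≠ 0 := by exact_mod_cast (den_pos P k).ne'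
  have h1 : (den P l : ℝ) ≠ 0 := by exact_mod_cast (den_pos P l).ne'
  have h2 : (P.m k : ℝ) ≠ 0 := by exact_mod_cast (by have := two_le_m P k; omega : P.m k ≠ 0)
  have h3 : (P.m l : ℝ) ≠ 0 := by exact_mod_cast (by have := two_le_m P l; omega : P.m l ≠ 0)
  have h4 : (den P l : ℝ) = den P k * P.m k * d := by
    rw [hd, Nat.succ_eq_add_one, den_succ]
    push_cast
    ring
  have h5 : (d : ℝ) ≠ 0 := by
    rintro h5
    rw [h5, mul_zero] at h4
    exact h1 h4
  have h6 : ((q * P.m k + r) * d * P.m l : ℕ) = q' * P.m l + r' := by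
    rw [den_succ, den_succ, Nat.cast_mul, Nat.cast_mul, h4] at h
    field_simp at h
    have : (((q * P.m k + r) * d * P.m l : ℕ) : ℝ) = (q' * P.m l + r' : ℕ) := by
      push_cast
      linarith
    exact_mod_cast this
  have h7 : P.m l ∣ r' := (Nat.dvd_add_right (dvd_mul_left _ q')).1 (h6 ▸ dvd_mul_left _ _)
  exact absurd (Nat.le_of_dvd (Nat.pos_of_ne_zero hr0) h7) (by omega)

theorem eq_of_mem_levels {k l : ℕ} {w : ℝ} (hk : w ∈ levels P k) (hl : w ∈ levels P l) : k = l :=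
  le_antisymm (not_lt.1 (not_lt_of_mem_levels hl hk)) (not_lt.1 (not_lt_of_mem_levels hk hl))

/-- Round `u` up to a multiple of `1 / den P k`, then add `1 / den P (k + 1)` to make the last digit
`1`. Each move costs at most `1 / den P k`. -/
theorem exists_mem_levels {k : ℕ} {u v : ℝ} (hu : 0 ≤ u) (hv : v ≤ 1)
    (huv : 2 / (den P k : ℝ) ≤ v - u) : ∃ w ∈ levels P k, w ∈ Icc u v := by
  have h0 : (0 : ℝ) < den P k := by exact_mod_cast den_pos P k
  have hm : (2 : ℝ) ≤ P.m k := by exact_mod_cast two_le_m P k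
  have hm' : (0 : ℝ) < P.m k := by linarith
  have h1 : (0 : ℝ) < 1 / den P (k + 1) := by
    have : (0 : ℝ) < den P (k + 1) := by exact_mod_cast den_pos P (k + 1)
    positivity
  have h2 : (1 : ℝ) / den P (k + 1) ≤ 1 / den P k := by
    rw [den_succ]
    push_cast
    gcongr
    nlinarith
  have h3 : u ≤ (⌈u * den P k⌉₊ : ℝ) / den P k := by
    rw [le_div_iff₀ h0]
    exact Nat.le_ceil _
  have h4 : (⌈u * den P k⌉₊ : ℝ) / den P k ≤ u + 1 / den P k := by
    rw [div_le_iff₀ h0, add_mul, one_div_mul_cancel h0.ne']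
    exact (Nat.ceil_lt_add_one (by positivity)).le
  have h5 : (2 : ℝ) / den P k = 1 / den P k + 1 / den P k := by ring
  have h6 : (⌈u * den P k⌉₊ : ℝ) / den P k + 1 / den P (k + 1) ≤ v := by linarith
  refine ⟨_, mem_levels_iff.2 ⟨⌈u * den P k⌉₊, ?_, 1, by have := two_le_m P k; omega, one_ne_zero,
    rfl⟩, ?_, ?_⟩
  · have h7 : (⌈u * den P k⌉₊ : ℝ) / den P k < 1 := by linarith
    rw [div_lt_one h0] at h7
    exact_mod_cast h7
  · push_cast
    linarith
  · push_cast
    linarith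

theorem mem_levels_nonempty (P : Params) (k : ℕ) : (Icc 0 1 ∩ levels P k).Nonempty := by
  have hq := den_pos P k
  have hm := two_le_m P k
  have h0 : (1 : ℝ) ≤ den P (k + 1) := by exact_mod_cast den_pos P (k + 1)
  have h1 : (1 : ℝ) / den P (k + 1) ≤ 1 := (div_le_one (by linarith)).2 h0
  exact ⟨1 / den P (k + 1), ⟨by positivity, h1⟩,
    mem_levels_iff.2 ⟨0, hq, 1, by omega, one_ne_zero, by simp⟩⟩

/-! ### Digits that survive the identification -/

@[simp] theorem height_proj (z : Cover P) : height (proj P z) = z.2 := rfl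

theorem continuous_proj (P : Params) : Continuous (proj P) := continuous_quot_mk

theorem isQuotientMap_proj (P : Params) : Topology.IsQuotientMap (proj P) := isQuotientMap_quot_mk

theorem continuous_height : Continuous (height (P := P)) :=
  continuous_quot_lift _ continuous_snd

theorem exists_proj (x : Space P) : ∃ a : ℕ → Bool, proj P (pt P a, height x) = x := by
  obtain ⟨⟨c, t⟩, rfl⟩ := Quot.exists_rep x
  obtain ⟨a, rfl⟩ := exists_pt c
  exact ⟨a, rfl⟩

theorem proj_eq_of_agree {k : ℕ} {t : I} (ht : (t : ℝ) ∈ levels P k) {a b : ℕ → Bool}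
    (h : ∀ j ≠ k, a j = b j) : proj P (pt P a, t) = proj P (pt P b, t) := by
  by_cases hk : a k = b k
  · have : a = b := funext fun j => if hj : j = k then hj ▸ hk else h j hj
    rw [this]
  · refine Quot.sound ⟨rfl, k, ht, a, rfl, ?_⟩
    have : b = switch k a := by
      funext j
      by_cases hj : j = k
      · subst hj
        simp only [switch, Function.update_self]
        cases ha : a j <;> cases hb : b j <;> simp_all
      · rw [switch, Function.update_of_ne hj, h j hj]
    rw [← this]
    rfl

/-- Off the levels of index `k`, every generating identification changes some other digit. The
predicate `D` is thus invariant and descends to the quotient, which handles the generated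
equivalence relation without chains. -/
theorem digit_eq_of_proj_eq {k : ℕ} {z z' : Cover P} (h : proj P z = proj P z')
    (hk : (z.2 : ℝ) ∉ levels P k) {a b : ℕ → Bool} (ha : (z.1 : ℝ) = point P a)
    (hb : (z'.1 : ℝ) = point P b) : a k = b k := by
  let D : Cover P → Prop := fun z => (z.2 : ℝ) ∉ levels P k ∧ ∃ a, (z.1 : ℝ) = point P a ∧ a k = true
  have hD : ∀ p q : Cover P, Wormhole P p q → D p = D q := by
    rintro p q ⟨h2, l, hl, c, hp, hq⟩
    refine propext (and_congr_right_iff.2 ?_ |>.trans (by rw [h2]))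
    intro hn
    have hlk : k ≠ l := fun e => hn (e ▸ hl)
    have e : switch l c k = c k := Function.update_of_ne hlk _ _
    constructor
    · rintro ⟨a, h1, h3⟩
      refine ⟨_, hq, ?_⟩
      rw [e, point_injective P (hp.symm.trans h1), h3]
    · rintro ⟨a, h1, h3⟩
      refine ⟨_, hp, ?_⟩
      rw [← e, point_injective P (hq.symm.trans h1), h3]
  have hz : D z = D z' := congrArg (Quot.lift D hD) h
  have h2 : z.2 = z'.2 := congrArg height h
  have e1 : D z ↔ a k = true := by
    refine ⟨?_, fun h => ⟨hk, a, ha, h⟩⟩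
    rintro ⟨-, c, hc, hc'⟩
    rw [point_injective P (ha.symm.trans hc), hc']
  have e2 : D z' ↔ b k = true := by
    refine ⟨?_, fun h => ⟨h2 ▸ hk, b, hb, h⟩⟩
    rintro ⟨-, c, hc, hc'⟩
    rw [point_injective P (hb.symm.trans hc), hc']
  rw [hz, e2] at e1
  cases h1 : a k <;> cases h3 : b k <;> simp_all

/-- The string of a point of the fractal. -/
noncomputable def digits (c : fractal P) : ℕ → Bool := (exists_pt c).choose

theorem pt_digits (c : fractal P) : pt P (digits c) = c := (exists_pt c).choose_spec

@[simp] theorem digits_pt (a : ℕ → Bool) : digits (pt P a) = a := pt_injective P (pt_digits _)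

theorem coe_eq_point_digits (c : fractal P) : (c : ℝ) = point P (digits c) :=
  (congrArg Subtype.val (pt_digits c)).symm

theorem isClosed_digits_eq (k : ℕ) (e : Bool) : IsClosed {c : fractal P | digits c k = e} := by
  have h : {c : fractal P | digits c k = e} = pt P '' {a | a k = e} := by
    ext c
    constructor
    · exact fun hc => ⟨digits c, hc, pt_digits c⟩
    · rintro ⟨a, ha, rfl⟩
      simpa using ha
  rw [h]
  exact ((isClosed_eq (continuous_apply k) continuous_const).isCompact.image
    (continuous_pt P)).isClosed

/-! ### Where a path can change a digit -/

/-- Two points of `Γ` at height `t` have the same digit in position `k`. -/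
def Agrees (Γ : Set (Cover P)) (k : ℕ) (t : ℝ) : Prop :=
  ∀ z ∈ Γ, ∀ z' ∈ Γ, (z.2 : ℝ) = t → (z'.2 : ℝ) = t → digits z.1 k = digits z'.1 k

/-- Without levels of index `k` in the band the set upstairs is saturated, so closedness can be
checked there. -/
theorem isClosed_proj_image_digit {k : ℕ} {t u : ℝ} (hk : Disjoint (Icc t u) (levels P k))
    (e : Bool) : IsClosed (proj P '' {z | digits z.1 k = e ∧ (z.2 : ℝ) ∈ Icc t u}) := by
  rw [← (isQuotientMap_proj P).isClosed_preimage]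
  have h : proj P ⁻¹' (proj P '' {z | digits z.1 k = e ∧ (z.2 : ℝ) ∈ Icc t u}) =
      {z | digits z.1 k = e ∧ (z.2 : ℝ) ∈ Icc t u} := by
    ext z
    constructor
    · rintro ⟨z', ⟨h1, h2⟩, h3⟩
      have h4 : z'.2 = z.2 := congrArg height h3
      refine ⟨?_, h4 ▸ h2⟩
      rw [← h1]
      exact (digit_eq_of_proj_eq h3 (disjoint_left.1 hk h2) (coe_eq_point_digits _)
        (coe_eq_point_digits _)).symm
    · exact fun hz => ⟨z, hz, rfl⟩
  rw [h]
  exact ((isClosed_digits_eq k e).preimage continuous_fst).inter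
    (isClosed_Icc.preimage (continuous_subtype_val.comp continuous_snd))

/-- If at most one digit is possible at the times in a closed set `R`, these can be sorted by
digits in a continuous manner. -/
theorem exists_closed_sorting {r R : I → Prop} {Q : Bool → Prop} (hR : IsClosed {τ | R τ})
    (hr : ∀ τ, r τ → R τ) (hQ : (∀ τ, ¬ r τ) ∨ ∃ e, Q e) :
    ∃ L : Bool → Set I, (∀ e, IsClosed (L e)) ∧ (∀ τ, r τ → ∃ e, τ ∈ L e) ∧
      (∀ e, ∀ τ ∈ L e, R τ ∧ Q e) ∧ ∀ e e' τ, τ ∈ L e → τ ∈ L e' → e = e' := by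
  rcases hQ with hQ | ⟨d, hd⟩
  · exact ⟨fun _ => ∅, fun _ => isClosed_empty, fun τ hτ => absurd hτ (hQ τ),
      fun _ _ h => h.elim, fun _ _ _ h => h.elim⟩
  · refine ⟨fun e => {τ | R τ ∧ e = d}, fun e => hR.inter isClosed_const,
      fun τ hτ => ⟨d, hr τ hτ, rfl⟩, ?_, fun e e' τ h h' => h.2.trans h'.2.symm⟩
    rintro e τ ⟨h, rfl⟩
    exact ⟨h, hd⟩

theorem exists_digit_of_agrees {Γ : Set (Cover P)} {k : ℕ} {t : ℝ} (h : Agrees Γ k t) :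
    ∃ e, ∀ z ∈ Γ, (z.2 : ℝ) = t → digits z.1 k = e := by
  by_cases hz : ∃ z ∈ Γ, (z.2 : ℝ) = t
  · obtain ⟨z, hz, hzt⟩ := hz
    exact ⟨digits z.1 k, fun z' hz' ht' => h z' hz' z hz ht' hzt⟩
  · push Not at hz
    -- `Γ` has no point at this height, so any digit serves.
    exact ⟨true, fun z hz' h => absurd h (hz z hz')⟩

/-- A path can only change a digit in a range of heights without wormhole levels of that order if
it meets both columns at one of the ends of the range. -/
theorem not_disjoint_levels_of_agrees {x y : Space P} (p : Path x y) {Γ : Set (Cover P)}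
    (hΓ : range p = proj P '' Γ) {k : ℕ} (hk : Required x y k) {t u : ℝ}
    (hx : (height x : ℝ) ∈ Icc t u) (hy : (height y : ℝ) ∈ Icc t u)
    (ht : t = 0 ∨ Agrees Γ k t) (hu : u = 1 ∨ Agrees Γ k u) :
    ¬ Disjoint (Icc t u) (levels P k) := by
  intro hdis
  have hf : Continuous fun τ => (height (p τ) : ℝ) :=
    continuous_subtype_val.comp (continuous_height.comp p.continuous)
  have hlift : ∀ τ, ∃ z ∈ Γ, proj P z = p τ := fun τ => by
    have h : p τ ∈ proj P '' Γ := hΓ ▸ mem_range_self τ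
    exact h
  obtain ⟨L, hLc, hLcov, hL, hLu⟩ := exists_closed_sorting
    (r := fun τ => (height (p τ) : ℝ) < t) (R := fun τ => (height (p τ) : ℝ) ≤ t)
    (Q := fun e => ∀ z ∈ Γ, (z.2 : ℝ) = t → digits z.1 k = e)
    (isClosed_le hf continuous_const) (fun _ h => h.le) (by
      refine ht.imp ?_ exists_digit_of_agrees
      rintro rfl τ
      exact not_lt.2 (height (p τ)).2.1)
  obtain ⟨U, hUc, hUcov, hU, hUu⟩ := exists_closed_sorting
    (r := fun τ => u < (height (p τ) : ℝ)) (R := fun τ => u ≤ (height (p τ) : ℝ))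
    (Q := fun e => ∀ z ∈ Γ, (z.2 : ℝ) = u → digits z.1 k = e)
    (isClosed_le continuous_const hf) (fun _ h => h.le) (by
      refine hu.imp ?_ exists_digit_of_agrees
      rintro rfl τ
      exact not_lt.2 (height (p τ)).2.2)
  -- Times in the band are sorted by their digit; times outside it get the common digit at the end
  -- through which the path left the band.
  let C : Bool → Set I := fun e => p ⁻¹' (proj P '' {z | digits z.1 k = e ∧ (z.2 : ℝ) ∈ Icc t u})
  let S : Bool → Set I := fun e => C e ∪ (L e ∪ U e)
  have hS : ∀ e, IsClosed (S e) := fun e =>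
    ((isClosed_proj_image_digit hdis e).preimage p.continuous).union ((hLc e).union (hUc e))
  have hcov : ∀ τ, ∃ e, τ ∈ S e := by
    intro τ
    rcases lt_or_ge (height (p τ) : ℝ) t with h1 | h1
    · exact (hLcov τ h1).imp fun e he => Or.inr (Or.inl he)
    rcases lt_or_ge u (height (p τ) : ℝ) with h2 | h2
    · exact (hUcov τ h2).imp fun e he => Or.inr (Or.inr he)
    obtain ⟨z, -, hz⟩ := hlift τ
    refine ⟨digits z.1 k, Or.inl ⟨z, ⟨rfl, ?_⟩, hz⟩⟩
    rw [← hz] at h1 h2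
    exact ⟨h1, h2⟩
  have hdig : ∀ e, ∀ τ ∈ S e, ∀ z ∈ Γ, proj P z = p τ → (z.2 : ℝ) ∈ Icc t u →
      digits z.1 k = e := by
    rintro e τ hτ z hz hzp hzt
    have hzh : z.2 = height (p τ) := by rw [← hzp, height_proj]
    rcases hτ with ⟨z', ⟨h1, h2⟩, h3⟩ | hτ | hτ
    · rw [← h1]
      exact digit_eq_of_proj_eq (hzp.trans h3.symm) (disjoint_left.1 hdis hzt)
        (coe_eq_point_digits _) (coe_eq_point_digits _)
    · obtain ⟨h1, h2⟩ := hL e τ hτ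
      exact h2 z hz (le_antisymm (hzh ▸ h1) hzt.1)
    · obtain ⟨h1, h2⟩ := hU e τ hτ
      exact h2 z hz (le_antisymm hzt.2 (hzh ▸ h1))
  obtain ⟨z₀, hz₀, hz₀x⟩ := hlift 0
  obtain ⟨z₁, hz₁, hz₁y⟩ := hlift 1
  rw [p.source] at hz₀x
  rw [p.target] at hz₁y
  have hne : digits z₀.1 k ≠ digits z₁.1 k :=
    hk z₀ z₁ _ _ hz₀x hz₁y (coe_eq_point_digits _) (coe_eq_point_digits _)
  have h0 : (0 : I) ∈ S (digits z₀.1 k) :=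
    Or.inl ⟨z₀, ⟨rfl, by rw [← hz₀x] at hx; exact hx⟩, by rw [hz₀x, p.source]⟩
  have h1 : (1 : I) ∈ S (digits z₁.1 k) :=
    Or.inl ⟨z₁, ⟨rfl, by rw [← hz₁y] at hy; exact hy⟩, by rw [hz₁y, p.target]⟩
  -- Two closed sets cover the time interval, one containing `0` and the other `1`; a common time
  -- `τ` would carry two different digits.
  obtain ⟨τ, -, hτ₀, hτ₁⟩ := isPreconnected_closed_iff.1 (isPreconnected_univ (α := I)) _ _
    (hS (digits z₀.1 k)) (hS (digits z₁.1 k)) (fun τ _ => by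
      obtain ⟨e, he⟩ := hcov τ
      by_cases h : e = digits z₀.1 k
      · exact Or.inl (h ▸ he)
      · exact Or.inr (((Bool.eq_not.2 h).trans (Bool.eq_not.2 hne.symm).symm) ▸ he)) ⟨0, mem_univ _, h0⟩ ⟨1, mem_univ _, h1⟩
  obtain ⟨z, hz, hzp⟩ := hlift τ
  by_cases hzt : (z.2 : ℝ) ∈ Icc t u
  · exact hne ((hdig _ τ hτ₀ z hz hzp hzt).symm.trans (hdig _ τ hτ₁ z hz hzp hzt))
  · have hzh : z.2 = height (p τ) := by rw [← hzp, height_proj]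
    have hC : ∀ e, τ ∉ C e := by
      rintro e ⟨z', ⟨-, h2⟩, h3⟩
      have h4 : z'.2 = z.2 := congrArg height (h3.trans hzp.symm)
      exact hzt (h4 ▸ h2)
    have htu : t ≤ u := hx.1.trans hx.2
    rcases hτ₀ with h | h | h
    · exact hC _ h
    · rcases hτ₁ with h' | h' | h'
      · exact hC _ h'
      · exact hne (hLu _ _ _ h h')
      · have h3 := (hL _ _ h).1
        have h4 := (hU _ _ h').1
        exact hzt ⟨hzh ▸ htu.trans h4, hzh ▸ h3.trans htu⟩
    · rcases hτ₁ with h' | h' | h'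
      · exact hC _ h'
      · have h3 := (hL _ _ h').1
        have h4 := (hU _ _ h).1
        exact hzt ⟨hzh ▸ htu.trans h4, hzh ▸ h3.trans htu⟩
      · exact hne (hUu _ _ _ h h')

/-! ### Hausdorff length and multiplicity of heights -/

theorem toPlane_injective (P : Params) : Function.Injective (toPlane (P := P)) := by
  intro z z' h
  have h0 := congrArg (fun v : EuclideanSpace ℝ (Fin 2) => v 0) h
  have h1 := congrArg (fun v : EuclideanSpace ℝ (Fin 2) => v 1) h
  exact Prod.ext (Subtype.ext (by simpa [toPlane] using h0)) (Subtype.ext (by simpa [toPlane] using h1))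

theorem continuous_toPlane (P : Params) : Continuous (toPlane (P := P)) := by
  refine (PiLp.continuous_toLp 2 _).comp (continuous_pi fun i => ?_)
  fin_cases i
  · exact continuous_subtype_val.comp continuous_fst
  · exact continuous_subtype_val.comp continuous_snd

instance (P : Params) : CompactSpace (fractal P) := isCompact_iff_compactSpace.1 (isCompact_fractal P)

/-- The second coordinate is 1-Lipschitz, and on the line `μH[1]` is Lebesgue measure. -/
theorem volume_heights_le (Γ : Set (Cover P)) :
    volume ((fun z : Cover P => (z.2 : ℝ)) '' Γ) ≤ hausdorffLength Γ := by
  have hl : LipschitzWith 1 fun v : EuclideanSpace ℝ (Fin 2) => v 1 := by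
    refine LipschitzWith.of_dist_le_mul fun v w => ?_
    rw [NNReal.coe_one, one_mul]
    simpa [dist_eq_norm] using PiLp.norm_apply_le (v - w) 1
  have h := hl.hausdorffMeasure_image_le (zero_le_one : (0 : ℝ) ≤ 1) (toPlane '' Γ)
  rw [image_image, hausdorffMeasure_real] at h
  simpa [toPlane, hausdorffLength] using h

/-- The points of the cover whose strings begin with the word `w`. -/
def cylinder (P : Params) {K : ℕ} (w : Fin K → Bool) : Set (Cover P) :=
  {z | ∀ i : Fin K, digits z.1 i = w i}

theorem isClosed_cylinder {K : ℕ} (w : Fin K → Bool) : IsClosed (cylinder P w) := by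
  simp only [cylinder, ofPred_forall]
  exact isClosed_iInter fun i => (isClosed_digits_eq i (w i)).preimage continuous_fst

/-- Cylinders have compact, pairwise disjoint images, so additivity applies to the restricted
measure although `Γ` is arbitrary. -/
theorem sum_hausdorffLength_le (Γ : Set (Cover P)) (K : ℕ) :
    ∑ w : Fin K → Bool, hausdorffLength (Γ ∩ cylinder P w) ≤ hausdorffLength Γ := by
  have hm : ∀ w : Fin K → Bool, MeasurableSet (toPlane '' cylinder P w) := fun w =>
    ((isClosed_cylinder w).isCompact.image (continuous_toPlane P)).measurableSet
  have h := sum_measure_le_measure_univ (μ := μH[1].restrict (toPlane '' Γ))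
    (s := (Finset.univ : Finset (Fin K → Bool))) (t := fun w => toPlane '' cylinder P w)
    (fun w _ => (hm w).nullMeasurableSet) (by
      intro w _ w' _ hw
      refine Disjoint.aedisjoint ?_
      rw [disjoint_image_iff (toPlane_injective P), disjoint_left]
      intro z hz hz'
      exact hw (funext fun i => (hz i).symm.trans (hz' i)))
  rw [Measure.restrict_apply_univ] at h
  refine le_trans (Finset.sum_le_sum fun w _ => ?_) h
  rw [Measure.restrict_apply (hm w), hausdorffLength, image_inter (toPlane_injective P), inter_comm]

/-- The length of a set is at least the measure of the heights which it attains, where the heights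
at which it meets two cylinders are counted twice. -/
theorem volume_add_two_mul_volume_le {Γ : Set (Cover P)} {K : ℕ} {A B : Set ℝ}
    (hA : MeasurableSet A) (hB : MeasurableSet B) (hAB : Disjoint A B)
    (hAΓ : ∀ t ∈ A, ∃ z ∈ Γ, (z.2 : ℝ) = t) (hBΓ : ∀ t ∈ B, ¬ ∀ k < K, Agrees Γ k t) :
    volume A + 2 * volume B ≤ hausdorffLength Γ := by
  -- The heights of an arbitrary `Γ` need not form a measurable set; a measurable hull has the same
  -- volume.
  let G : (Fin K → Bool) → Set ℝ := fun w =>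
    toMeasurable volume ((fun z : Cover P => (z.2 : ℝ)) '' (Γ ∩ cylinder P w))
  have hG : ∀ w, MeasurableSet (G w) := fun w => measurableSet_toMeasurable _ _
  have hmem : ∀ z ∈ Γ, (z.2 : ℝ) ∈ G fun i => digits z.1 i := fun z hz =>
    subset_toMeasurable _ _ ⟨z, ⟨hz, fun _ => rfl⟩, rfl⟩
  have hle : ∀ t, A.indicator 1 t + 2 * B.indicator (1 : ℝ → ℝ≥0∞) t ≤
      ∑ w, (G w).indicator 1 t := by
    intro t
    by_cases hB' : t ∈ B
    · rw [indicator_of_notMem (disjoint_right.1 hAB hB'), indicator_of_mem hB', zero_add]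
      have h := hBΓ t hB'
      simp only [Agrees] at h
      push Not at h
      obtain ⟨k, hk, z, hz, z', hz', rfl, ht, hne⟩ := h
      have hw : (fun i : Fin K => digits z.1 i) ≠ fun i : Fin K => digits z'.1 i := fun e =>
        hne (congrFun e ⟨k, hk⟩)
      refine le_trans ?_ (Finset.sum_le_sum_of_subset (Finset.subset_univ
        {fun i : Fin K => digits z.1 i, fun i : Fin K => digits z'.1 i}))
      rw [Finset.sum_pair hw, indicator_of_mem (hmem z hz), indicator_of_mem (ht ▸ hmem z' hz')]
      simp [one_add_one_eq_two]
    · rw [indicator_of_notMem hB', mul_zero, add_zero]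
      by_cases hA' : t ∈ A
      · obtain ⟨z, hz, rfl⟩ := hAΓ t hA'
        rw [indicator_of_mem hA', ← indicator_of_mem (hmem z hz) (1 : ℝ → ℝ≥0∞)]
        exact Finset.single_le_sum (f := fun w => (G w).indicator (1 : ℝ → ℝ≥0∞) (z.2 : ℝ))
          (fun _ _ => zero_le) (Finset.mem_univ _)
      · rw [indicator_of_notMem hA']
        exact zero_le
  have h1m : Measurable (1 : ℝ → ℝ≥0∞) := measurable_const
  calc volume A + 2 * volume B
      = ∫⁻ t, A.indicator 1 t + 2 * B.indicator (1 : ℝ → ℝ≥0∞) t := by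
        rw [lintegral_add_left (h1m.indicator hA), lintegral_const_mul _ (h1m.indicator hB),
          lintegral_indicator_one hA, lintegral_indicator_one hB]
    _ ≤ ∫⁻ t, ∑ w, (G w).indicator 1 t := lintegral_mono hle
    _ = ∑ w, volume (G w) := by
        rw [lintegral_finsetSum _ fun w _ => h1m.indicator (hG w)]
        exact Finset.sum_congr rfl fun w _ => lintegral_indicator_one (hG w)
    _ ≤ ∑ w, hausdorffLength (Γ ∩ cylinder P w) := by
        refine Finset.sum_le_sum fun w _ => ?_
        rw [measure_toMeasurable]
        exact volume_heights_le _
    _ ≤ hausdorffLength Γ := sum_hausdorffLength_le Γ K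

/-! ### The lower bound for the distance -/

theorem IsMinimalInterval.le_length {x y : Space P} {a b : ℝ} (h : IsMinimalInterval x y a b)
    (p : Path x y) {Γ : Set (Cover P)} (hΓ : range p = proj P '' Γ) :
    ENNReal.ofReal (2 * b - 2 * a - |(height y : ℝ) - (height x : ℝ)|) ≤ hausdorffLength Γ := by
  obtain ⟨⟨ha0, hab, hb1, hxab, hyab, -⟩, hmin⟩ := h
  rcases hab.eq_or_lt with rfl | hlt
  · rw [ENNReal.ofReal_of_nonpos (by linarith [abs_nonneg ((height y : ℝ) - (height x : ℝ))])]
    exact zero_le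
  set hx := ((height x : I) : ℝ) with hhx
  set hy := ((height y : I) : ℝ) with hhy
  have hx0 : 0 ≤ hx := (height x).2.1
  have hx1 : hx ≤ 1 := (height x).2.2
  have hy0 : 0 ≤ hy := (height y).2.1
  have hy1 : hy ≤ 1 := (height y).2.2
  set lo := min hx hy with hlo
  set hi := max hx hy with hhi
  have hlohi : lo ≤ hi := min_le_max
  have hlo0 : 0 ≤ lo := le_min hx0 hy0
  have hhi1 : hi ≤ 1 := max_le hx1 hy1
  -- From index `K` on, levels occur in every subinterval of `[0, 1]` of length `(b - a) / 2`, so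
  -- only finitely many digits need watching.
  obtain ⟨K, hK⟩ := exists_two_div_den_lt P (half_pos (sub_pos.2 hlt))
  have hgood : ∀ t ∈ Icc 0 lo, ∀ u ∈ Icc hi 1, (t = 0 ∨ ∀ k < K, Agrees Γ k t) →
      (u = 1 ∨ ∀ k < K, Agrees Γ k u) → b - a ≤ u - t := by
    rintro t ⟨ht0, ht⟩ u ⟨hu, hu1⟩ htK huK
    by_contra! hcon
    -- A too short `[t, u]` is enlarged to length `ℓ`: enough for the indices from `K` on, still
    -- less than `b - a`. The choice of `t'` keeps it inside `[0, 1]`.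
    set ℓ := max (u - t) ((b - a) / 2) with hℓ
    have hℓlt : ℓ < b - a := max_lt hcon (by linarith)
    have hℓ1 : u - t ≤ ℓ := le_max_left _ _
    have hℓ2 : (b - a) / 2 ≤ ℓ := le_max_right _ _
    set t' := max 0 (u - ℓ) with ht'
    have ht'0 : 0 ≤ t' := le_max_left _ _
    have ht't : t' ≤ t := max_le ht0 (by linarith)
    have hut' : u ≤ t' + ℓ := by linarith [le_max_right 0 (u - ℓ)]
    have hu' : t' + ℓ ≤ 1 := by
      rcases le_total 0 (u - ℓ) with h | h
      · rw [ht', max_eq_right h]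
        linarith
      · rw [ht', max_eq_left h]
        linarith
    have hxt : hx ∈ Icc t u := ⟨ht.trans (min_le_left _ _), (le_max_left _ _).trans hu⟩
    have hyt : hy ∈ Icc t u := ⟨ht.trans (min_le_right _ _), (le_max_right _ _).trans hu⟩
    have hsub : Icc t u ⊆ Icc t' (t' + ℓ) := Icc_subset_Icc ht't hut'
    have := hmin t' (t' + ℓ) ⟨ht'0, by linarith, hu', hsub hxt, hsub hyt, fun k hk => ?_⟩
    · linarith
    · rcases lt_or_ge k K with hkK | hkK
      · exact (not_disjoint_iff_nonempty_inter.1 (not_disjoint_levels_of_agrees p hΓ hk hxt hyt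
          (htK.imp_right fun h => h k hkK) (huK.imp_right fun h => h k hkK))).mono
          (inter_subset_inter_left _ hsub)
      · obtain ⟨w, hw, hw'⟩ := exists_mem_levels (P := P) (k := k) ht'0 hu'
          (by linarith [hK k hkK])
        exact ⟨w, hw', hw⟩
  -- The extremal heights `sSup T` and `sInf U` need not be attained; only the open gaps beyond them
  -- enter `B`, and there `Γ` disagrees.
  set T := {t | t ∈ Icc 0 lo ∧ (t = 0 ∨ ∀ k < K, Agrees Γ k t)} with hT
  set U := {u | u ∈ Icc hi 1 ∧ (u = 1 ∨ ∀ k < K, Agrees Γ k u)} with hU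
  have h0T : (0 : ℝ) ∈ T := ⟨⟨le_rfl, hlo0⟩, Or.inl rfl⟩
  have h1U : (1 : ℝ) ∈ U := ⟨⟨hhi1, le_rfl⟩, Or.inl rfl⟩
  have hTb : BddAbove T := ⟨lo, fun t ht => ht.1.2⟩
  have hUb : BddBelow U := ⟨hi, fun u hu => hu.1.1⟩
  have hTlo : sSup T ≤ lo := csSup_le ⟨0, h0T⟩ fun t ht => ht.1.2
  have hUhi : hi ≤ sInf U := le_csInf ⟨1, h1U⟩ fun u hu => hu.1.1
  have hTU : b - a ≤ sInf U - sSup T := by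
    have h1 : sSup T + (b - a) ≤ sInf U := by
      refine le_csInf ⟨1, h1U⟩ fun u hu => ?_
      have h2 : sSup T ≤ u - (b - a) := by
        refine csSup_le ⟨0, h0T⟩ fun t ht => ?_
        linarith [hgood t ht.1 u hu.1 ht.2 hu.2]
      linarith
    linarith
  have hmain := volume_add_two_mul_volume_le (Γ := Γ) (K := K) (A := Icc lo hi)
    (B := Ioo (sSup T) lo ∪ Ioo hi (sInf U)) measurableSet_Icc
    (measurableSet_Ioo.union measurableSet_Ioo) (by
      rw [disjoint_left]
      rintro t ⟨h1, h2⟩ (h | h)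
      · exact absurd h1 (not_le.2 h.2)
      · exact absurd h2 (not_le.2 h.1)) (by
      intro t ht
      have hf : Continuous fun τ => (height (p τ) : ℝ) :=
        continuous_subtype_val.comp (continuous_height.comp p.continuous)
      have h1 := (isPreconnected_range hf).ordConnected.uIcc_subset (mem_range_self 0)
        (mem_range_self 1)
      simp only [p.source, p.target] at h1
      obtain ⟨τ, hτ⟩ := h1 ht
      have h2 : p τ ∈ proj P '' Γ := hΓ ▸ mem_range_self τ
      obtain ⟨z, hz, hz'⟩ := h2
      refine ⟨z, hz, ?_⟩
      rw [← hτ]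
      simp only [← hz', height_proj]) (by
      rintro t (ht | ht) hag
      · exact absurd (le_csSup hTb ⟨⟨(le_csSup hTb h0T).trans ht.1.le, ht.2.le⟩, Or.inr hag⟩)
          (not_le.2 ht.1)
      · exact absurd (csInf_le hUb ⟨⟨ht.1.le, ht.2.le.trans (csInf_le hUb h1U)⟩, Or.inr hag⟩)
          (not_le.2 ht.2))
  refine le_trans ?_ hmain
  have hdisj : Disjoint (Ioo (sSup T) lo) (Ioo hi (sInf U)) := by
    rw [disjoint_left]
    intro t h1 h2
    exact absurd (h1.2.trans_le hlohi) (not_lt.2 h2.1.le)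
  rw [measure_union hdisj measurableSet_Ioo, Real.volume_Icc, Real.volume_Ioo, Real.volume_Ioo,
    ← ENNReal.ofReal_add (by linarith) (by linarith), ← ENNReal.ofReal_ofNat 2,
    ← ENNReal.ofReal_mul (by norm_num), ← ENNReal.ofReal_add (by linarith) (by linarith)]
  refine ENNReal.ofReal_le_ofReal ?_
  have habs : |hy - hx| = hi - lo := (max_sub_min_eq_abs hx hy).symm
  rw [habs]
  linarith

theorem IsMinimalInterval.le_laaksoDist {x y : Space P} {a b : ℝ}
    (h : IsMinimalInterval x y a b) :
    ENNReal.ofReal (2 * b - 2 * a - |(height y : ℝ) - (height x : ℝ)|) ≤ laaksoDist x y :=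
  le_iInf₂ fun _ ⟨p, hp⟩ => h.le_length p hp

/-! ### Existence of minimal height intervals -/

theorem isClosed_Icc_inter_nonempty {J : Set ℝ} (hJ : J.Finite) :
    IsClosed {q : ℝ × ℝ | (Icc q.1 q.2 ∩ J).Nonempty} := by
  have h : {q : ℝ × ℝ | (Icc q.1 q.2 ∩ J).Nonempty} = ⋃ w ∈ J, {q | q.1 ≤ w ∧ w ≤ q.2} := by
    ext q
    simp only [mem_iUnion, exists_prop]
    exact ⟨fun ⟨w, h1, h2⟩ => ⟨w, h2, h1⟩, fun ⟨w, h2, h1⟩ => ⟨w, h1, h2⟩⟩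
  rw [h]
  exact hJ.isClosed_biUnion fun w _ => (isClosed_le continuous_fst continuous_const).inter
    (isClosed_le continuous_const continuous_snd)

/-- Admissible pairs form a compact set, each level set being finite, and `(0, 1)` is one of them;
the continuous length attains its minimum. -/
theorem exists_isMinimalInterval (x y : Space P) : ∃ a b : ℝ, IsMinimalInterval x y a b := by
  let A : Set (ℝ × ℝ) := {q | IsAdmissible x y q.1 q.2}
  have hA : IsClosed A := by
    have h : A = {q : ℝ × ℝ | 0 ≤ q.1} ∩ ({q | q.1 ≤ q.2} ∩ ({q | q.2 ≤ 1} ∩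
        (({q | q.1 ≤ height x} ∩ {q | height x ≤ q.2}) ∩
        (({q | q.1 ≤ height y} ∩ {q | height y ≤ q.2}) ∩
        ⋂ k, ⋂ _ : Required x y k, {q | (Icc q.1 q.2 ∩ levels P k).Nonempty})))) := by
      ext q
      simp only [A, IsAdmissible, mem_inter_iff, mem_iInter]
      rfl
    rw [h]
    have h1 : Continuous fun q : ℝ × ℝ => q.1 := continuous_fst
    have h2 : Continuous fun q : ℝ × ℝ => q.2 := continuous_snd
    exact (isClosed_le continuous_const h1).inter ((isClosed_le h1 h2).inter
      ((isClosed_le h2 continuous_const).inter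
      (((isClosed_le h1 continuous_const).inter (isClosed_le continuous_const h2)).inter
      (((isClosed_le h1 continuous_const).inter (isClosed_le continuous_const h2)).inter
      (isClosed_iInter fun k => isClosed_iInter fun _ =>
        isClosed_Icc_inter_nonempty (finite_levels P k))))))
  have hc : IsCompact A := by
    refine (isCompact_Icc.prod isCompact_Icc).of_isClosed_subset
      (t := A) (s := Icc (0 : ℝ) 1 ×ˢ Icc (0 : ℝ) 1) hA ?_
    rintro ⟨a, b⟩ ⟨h0, hab, h1, -⟩
    exact ⟨⟨h0, hab.trans h1⟩, ⟨h0.trans hab, h1⟩⟩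
  obtain ⟨q, hq, hmin⟩ := hc.exists_isMinOn
    ⟨(0, 1), le_rfl, zero_le_one, le_rfl, (height x).2, (height y).2,
      fun k _ => mem_levels_nonempty P k⟩
    (f := fun q : ℝ × ℝ => q.2 - q.1) (by fun_prop)
  exact ⟨q.1, q.2, hq, fun a' b' h => hmin (a := (a', b')) h⟩

/-! ### Length of associated paths -/

theorem hausdorffLength_column_le {ι : Type*} (c : fractal P) (g : ι → I) (S : Set ι) :
    hausdorffLength ((fun t => ((c, g t) : Cover P)) '' S) ≤
      volume ((fun t => (g t : ℝ)) '' S) := by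
  have hl : LipschitzWith 1 fun r : ℝ => (!₂[(c : ℝ), r] : EuclideanSpace ℝ (Fin 2)) := by
    refine LipschitzWith.of_dist_le_mul fun v w => ?_
    rw [NNReal.coe_one, one_mul, EuclideanSpace.dist_eq, Fin.sum_univ_two]
    simp [Real.sqrt_sq dist_nonneg]
  have h := hl.hausdorffMeasure_image_le (zero_le_one : (0 : ℝ) ≤ 1) ((fun t => (g t : ℝ)) '' S)
  rw [image_image, hausdorffMeasure_real] at h
  rw [hausdorffLength, image_image]
  simpa [toPlane] using h

/-- Two successive pieces of a monotone leg can share only one height, so countably many pieces have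
additive volume. -/
theorem subsingleton_image_inter_of_le {f : I → ℝ} {L S T : Set I}
    (hf : MonotoneOn f L ∨ AntitoneOn f L) (hST : ∀ s ∈ S, ∀ t ∈ T, s ≤ t) :
    (f '' (S ∩ L) ∩ f '' (T ∩ L)).Subsingleton := by
  rintro _ ⟨⟨s, hs, rfl⟩, ⟨t, ht, hst⟩⟩ _ ⟨⟨s', hs', rfl⟩, ⟨t', ht', hst'⟩⟩
  have h1 := hST s hs.1 t' ht'.1
  have h2 := hST s' hs'.1 t ht.1
  rcases hf with hf | hf
  · have h3 := hf hs.2 ht'.2 h1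
    have h4 := hf hs'.2 ht.2 h2
    exact le_antisymm (h3.trans hst'.le) (h4.trans hst.le)
  · have h3 := hf hs.2 ht'.2 h1
    have h4 := hf hs'.2 ht.2 h2
    exact le_antisymm (hst.ge.trans h4) (hst'.ge.trans h3)

namespace SegmentPath

variable {x y : Space P} (γ : SegmentPath x y)

theorem continuous_height_path : Continuous fun t => (height (γ.path t) : ℝ) :=
  continuous_subtype_val.comp (continuous_height.comp γ.path.continuous)

theorem aedisjoint_image {L : Set I}
    (hL : MonotoneOn (fun t => (height (γ.path t) : ℝ)) L ∨
      AntitoneOn (fun t => (height (γ.path t) : ℝ)) L) {i j : ℕ} (hij : i ≠ j) :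
    AEDisjoint volume ((fun t => (height (γ.path t) : ℝ)) '' (Icc (γ.left i) (γ.right i) ∩ L))
      ((fun t => (height (γ.path t) : ℝ)) '' (Icc (γ.left j) (γ.right j) ∩ L)) := by
  have hsub : ∀ k, γ.left k = γ.right k →
      ((fun t => (height (γ.path t) : ℝ)) '' (Icc (γ.left k) (γ.right k) ∩ L)).Subsingleton := by
    intro k hk
    rw [hk, Icc_self]
    exact (subsingleton_singleton.anti inter_subset_left).image _
  refine Subsingleton.measure_zero ?_ _
  rcases (γ.left_le_right i).eq_or_lt with hi | hi
  · exact (hsub i hi).anti inter_subset_left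
  rcases (γ.left_le_right j).eq_or_lt with hj | hj
  · exact (hsub j hj).anti inter_subset_right
  have h := γ.nonoverlapping i j hij
  rw [Ioo_disjoint_Ioo, min_le_iff, le_max_iff, le_max_iff] at h
  rcases h with (h | h) | (h | h)
  · exact absurd h (not_le.2 hi)
  · exact subsingleton_image_inter_of_le hL fun s hs t ht => hs.2.trans (h.trans ht.1)
  · rw [inter_comm]
    exact subsingleton_image_inter_of_le hL fun s hs t ht => hs.2.trans (h.trans ht.1)
  · exact absurd h (not_le.2 hj)

/-- The part of the lift during a period of time. -/
def liftOn (L : Set I) : Set (Cover P) :=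
  ⋃ j, (fun t => (γ.col j, height (γ.path t))) '' (Icc (γ.left j) (γ.right j) ∩ L)

/-- The height images of the pieces are almost disjoint, so the sum over columns is the volume of a
single union, contained between the two end heights. -/
theorem hausdorffLength_liftOn_le {u v : I} (huv : u ≤ v)
    (h : MonotoneOn (fun t => height (γ.path t)) (Icc u v) ∨
      AntitoneOn (fun t => height (γ.path t)) (Icc u v)) :
    hausdorffLength (γ.liftOn (Icc u v)) ≤
      ENNReal.ofReal |(height (γ.path v) : ℝ) - height (γ.path u)| := by
  have hL : MonotoneOn (fun t => (height (γ.path t) : ℝ)) (Icc u v) ∨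
      AntitoneOn (fun t => (height (γ.path t) : ℝ)) (Icc u v) :=
    h.imp (fun h s hs t ht hst => h hs ht hst) fun h s hs t ht hst => h hs ht hst
  calc hausdorffLength (γ.liftOn (Icc u v))
      ≤ ∑' j, hausdorffLength ((fun t => (γ.col j, height (γ.path t))) ''
          (Icc (γ.left j) (γ.right j) ∩ Icc u v)) := by
        rw [hausdorffLength, liftOn, image_iUnion]
        exact measure_iUnion_le _
    _ ≤ ∑' j, volume ((fun t => (height (γ.path t) : ℝ)) ''
          (Icc (γ.left j) (γ.right j) ∩ Icc u v)) :=
        ENNReal.tsum_le_tsum fun j => hausdorffLength_column_le _ _ _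
    _ = volume (⋃ j, (fun t => (height (γ.path t) : ℝ)) ''
          (Icc (γ.left j) (γ.right j) ∩ Icc u v)) := by
        refine (measure_iUnion₀ (fun i j hij => γ.aedisjoint_image hL hij) fun j => ?_).symm
        exact (((isCompact_Icc.inter isCompact_Icc).image
          γ.continuous_height_path).measurableSet).nullMeasurableSet
    _ ≤ volume (uIcc (height (γ.path u) : ℝ) (height (γ.path v))) := by
        refine measure_mono (iUnion_subset fun j => ?_)
        rintro _ ⟨t, ⟨-, ht⟩, rfl⟩
        rcases hL with hL | hL
        · exact Icc_subset_uIcc ⟨hL ⟨le_rfl, huv⟩ ht ht.1, hL ht ⟨huv, le_rfl⟩ ht.2⟩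
        · exact Icc_subset_uIcc' ⟨hL ht ⟨huv, le_rfl⟩ ht.2, hL ⟨le_rfl, huv⟩ ht ht.1⟩
    _ = _ := Real.volume_interval

theorem length_le_of_isAssociated {a b : ℝ} (h : γ.IsAssociated a b) :
    γ.length ≤ ENNReal.ofReal (2 * b - 2 * a - |(height y : ℝ) - (height x : ℝ)|) := by
  obtain ⟨t₁, t₂, h12, -, -, h⟩ := h
  have h01 : (0 : I) ≤ t₁ := unitInterval.nonneg'
  have h21 : t₂ ≤ (1 : I) := unitInterval.le_one'
  have hm : (MonotoneOn (fun t => height (γ.path t)) (Icc 0 t₁) ∨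
      AntitoneOn (fun t => height (γ.path t)) (Icc 0 t₁)) ∧
      (MonotoneOn (fun t => height (γ.path t)) (Icc t₁ t₂) ∨
      AntitoneOn (fun t => height (γ.path t)) (Icc t₁ t₂)) ∧
      (MonotoneOn (fun t => height (γ.path t)) (Icc t₂ 1) ∨
      AntitoneOn (fun t => height (γ.path t)) (Icc t₂ 1)) := by tauto
  have hsub : γ.lift ⊆ γ.liftOn (Icc 0 t₁) ∪ (γ.liftOn (Icc t₁ t₂) ∪ γ.liftOn (Icc t₂ 1)) := by
    rintro _ ⟨j, t, ht, rfl⟩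
    rcases le_total t t₁ with h1 | h1
    · exact Or.inl (mem_iUnion.2 ⟨j, t, ⟨ht, unitInterval.nonneg', h1⟩, rfl⟩)
    rcases le_total t t₂ with h2 | h2
    · exact Or.inr (Or.inl (mem_iUnion.2 ⟨j, t, ⟨ht, h1, h2⟩, rfl⟩))
    · exact Or.inr (Or.inr (mem_iUnion.2 ⟨j, t, ⟨ht, h2, unitInterval.le_one'⟩, rfl⟩))
  have hlen : γ.length ≤ ENNReal.ofReal |(height (γ.path t₁) : ℝ) - height (γ.path 0)| +
      (ENNReal.ofReal |(height (γ.path t₂) : ℝ) - height (γ.path t₁)| +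
      ENNReal.ofReal |(height (γ.path 1) : ℝ) - height (γ.path t₂)|) := by
    refine (measure_mono (image_mono hsub)).trans ?_
    rw [image_union, image_union]
    refine (measure_union_le _ _).trans (add_le_add (γ.hausdorffLength_liftOn_le h01 hm.1)
      ((measure_union_le _ _).trans (add_le_add (γ.hausdorffLength_liftOn_le h12 hm.2.1)
      (γ.hausdorffLength_liftOn_le h21 hm.2.2))))
  rw [← ENNReal.ofReal_add (abs_nonneg _) (abs_nonneg _),
    ← ENNReal.ofReal_add (abs_nonneg _) (by positivity), γ.path.source, γ.path.target] at hlen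
  refine hlen.trans (ENNReal.ofReal_le_ofReal ?_)
  rcases h with ⟨hxy, m1, rfl, m2, rfl, m3⟩ | ⟨hxy, m1, rfl, m2, rfl, m3⟩
  · have e1 : (height (γ.path t₁) : ℝ) ≤ height (γ.path 0) := m1 ⟨le_rfl, h01⟩ ⟨h01, le_rfl⟩ h01
    have e2 : (height (γ.path t₁) : ℝ) ≤ height (γ.path t₂) :=
      m2 ⟨le_rfl, h12⟩ ⟨h12, le_rfl⟩ h12
    have e3 : (height (γ.path 1) : ℝ) ≤ height (γ.path t₂) := m3 ⟨le_rfl, h21⟩ ⟨h21, le_rfl⟩ h21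
    rw [γ.path.source] at e1
    rw [γ.path.target] at e3
    have e4 : (height x : ℝ) ≤ height y := hxy
    rw [abs_of_nonneg (sub_nonneg.2 e4), abs_of_nonneg (sub_nonneg.2 e2),
      abs_of_nonpos (sub_nonpos.2 e1), abs_of_nonpos (sub_nonpos.2 e3)]
    linarith
  · have e1 : (height (γ.path 0) : ℝ) ≤ height (γ.path t₁) := m1 ⟨le_rfl, h01⟩ ⟨h01, le_rfl⟩ h01
    have e2 : (height (γ.path t₂) : ℝ) ≤ height (γ.path t₁) :=
      m2 ⟨le_rfl, h12⟩ ⟨h12, le_rfl⟩ h12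
    have e3 : (height (γ.path t₂) : ℝ) ≤ height (γ.path 1) := m3 ⟨le_rfl, h21⟩ ⟨h21, le_rfl⟩ h21
    rw [γ.path.source] at e1
    rw [γ.path.target] at e3
    have e4 : (height y : ℝ) ≤ height x := hxy
    rw [abs_of_nonpos (sub_nonpos.2 e4), abs_of_nonpos (sub_nonpos.2 e2),
      abs_of_nonneg (sub_nonneg.2 e1), abs_of_nonneg (sub_nonneg.2 e3)]
    linarith

theorem laaksoDist_le_length : laaksoDist x y ≤ γ.length := by
  refine iInf₂_le γ.lift ⟨γ.path, ?_⟩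
  ext z
  constructor
  · rintro ⟨t, rfl⟩
    obtain ⟨j, hj⟩ := γ.cover t
    exact ⟨_, ⟨j, t, hj, rfl⟩, (γ.path_eq j t hj).symm⟩
  · rintro ⟨_, ⟨j, t, ht, rfl⟩, rfl⟩
    exact ⟨t, γ.path_eq j t ht⟩

end SegmentPath

/-! ### Choice of representatives and indexing of segments -/

/-- At a level of index `k` the digit in position `k` is free and can be copied from the other
point. The strings then differ only where both digits are forced. -/
theorem exists_strings (x y : Space P) : ∃ α β : ℕ → Bool, proj P (pt P α, height x) = x ∧
    proj P (pt P β, height y) = y ∧ ∀ k, α k ≠ β k → Required x y k := by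
  classical
  obtain ⟨α₀, hα₀⟩ := exists_proj x
  obtain ⟨β₀, hβ₀⟩ := exists_proj y
  have hmod : ∀ (z : Space P) (α γ : ℕ → Bool), proj P (pt P α, height z) = z →
      proj P (pt P fun k => if (height z : ℝ) ∈ levels P k then γ k else α k, height z) = z := by
    intro z α γ hα
    conv_rhs => rw [← hα]
    by_cases h : ∃ l, (height z : ℝ) ∈ levels P l
    · obtain ⟨l, hl⟩ := h
      refine proj_eq_of_agree hl fun j hj => if_neg fun h => hj (eq_of_mem_levels h hl)
    · push Not at h
      simp only [h, if_false]
  refine ⟨_, _, hmod x α₀ β₀ hα₀,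
    hmod y β₀ (fun k => if (height x : ℝ) ∈ levels P k then β₀ k else α₀ k) hβ₀, ?_⟩
  intro k hk p q a b hp hq ha hb
  by_cases hy : (height y : ℝ) ∈ levels P k
  · simp [hy] at hk
  by_cases hx : (height x : ℝ) ∈ levels P k
  · simp [hx, hy] at hk
  have h1 : a k = α₀ k := (digit_eq_of_proj_eq (hα₀.trans hp.symm) hx rfl ha).symm
  have h2 : b k = β₀ k := (digit_eq_of_proj_eq (hβ₀.trans hq.symm) hy rfl hb).symm
  simpa [hx, hy, h1, h2] using hk

/-- Natural numbers outside the image of the index type get the one-point interval at time `0`, in a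
column through `x`. -/
theorem exists_segmentPath_of_countable {x y : Space P} {ι : Type*} [Countable ι] (p : Path x y)
    (col : ι → fractal P) (left right : ι → I) (hle : ∀ i, left i ≤ right i)
    (hcover : ∀ t : I, ∃ i, t ∈ Icc (left i) (right i))
    (hdis : ∀ i j, i ≠ j → Disjoint (Ioo (left i) (right i)) (Ioo (left j) (right j)))
    (heq : ∀ i, ∀ t ∈ Icc (left i) (right i), p t = proj P (col i, height (p t)))
    (hmono : ∀ i, MonotoneOn (fun t => height (p t)) (Icc (left i) (right i)) ∨
      AntitoneOn (fun t => height (p t)) (Icc (left i) (right i))) :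
    ∃ γ : SegmentPath x y, γ.path = p := by
  obtain ⟨e, he⟩ := exists_injective_nat ι
  obtain ⟨a, ha⟩ := exists_proj x
  let L : ℕ → I := Function.extend e left 0
  let R : ℕ → I := Function.extend e right 0
  let C : ℕ → fractal P := Function.extend e col fun _ => pt P a
  have hcase : ∀ n, (∃ i, e i = n ∧ L n = left i ∧ R n = right i ∧ C n = col i) ∨
      (L n = 0 ∧ R n = 0 ∧ C n = pt P a) := by
    intro n
    by_cases h : ∃ i, e i = n
    · obtain ⟨i, rfl⟩ := h
      exact Or.inl ⟨i, rfl, he.extend_apply _ _ _, he.extend_apply _ _ _, he.extend_apply _ _ _⟩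
    · exact Or.inr ⟨Function.extend_apply' _ _ _ h, Function.extend_apply' _ _ _ h,
        Function.extend_apply' _ _ _ h⟩
  refine ⟨⟨p, C, L, R, fun n => ?_, fun t => ?_, fun m n hmn => ?_, fun n => ?_, fun n => ?_⟩, rfl⟩
  · rcases hcase n with ⟨i, -, h1, h2, -⟩ | ⟨h1, h2, -⟩ <;> rw [h1, h2]
    exact hle i
  · obtain ⟨i, hi⟩ := hcover t
    refine ⟨e i, ?_⟩
    have h1 : L (e i) = left i := he.extend_apply _ _ _
    have h2 : R (e i) = right i := he.extend_apply _ _ _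
    rwa [h1, h2]
  · rcases hcase m with ⟨i, hi, h1, h2, -⟩ | ⟨h1, h2, -⟩
    · rcases hcase n with ⟨j, hj, h3, h4, -⟩ | ⟨h3, h4, -⟩
      · rw [h1, h2, h3, h4]
        refine hdis i j ?_
        rintro rfl
        exact hmn (hi.symm.trans hj)
      · rw [h3, h4, Ioo_self]
        exact disjoint_empty _
    · rw [h1, h2, Ioo_self]
      exact empty_disjoint _
  · rcases hcase n with ⟨i, -, h1, h2, h3⟩ | ⟨h1, h2, h3⟩ <;> rw [h1, h2, h3]
    · exact heq i
    · rintro t ht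
      rw [Icc_self, mem_singleton_iff] at ht
      rw [ht, p.source, ha]
  · rcases hcase n with ⟨i, -, h1, h2, -⟩ | ⟨h1, h2, -⟩ <;> rw [h1, h2]
    · exact hmono i
    · rw [Icc_self]
      exact Or.inl (subsingleton_singleton.monotoneOn _)

/-! ### Paths that switch digits one at a time -/

section Switching

variable {α β : ℕ → Bool} {θ : ℕ → I} {η : I → I}

/-- The string at time `t` if the digit in position `k` is switched from `α k` to `β k` at time
`θ k`. -/
noncomputable def switching (α β : ℕ → Bool) (θ : ℕ → I) (t : I) (k : ℕ) : Bool :=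
  if θ k ≤ t then β k else α k

theorem continuousAt_switching_apply {t₀ : I} {j : ℕ} (h : α j ≠ β j → θ j ≠ t₀) :
    ContinuousAt (fun t => switching α β θ t j) t₀ := by
  by_cases hj : α j = β j
  · simp only [switching, hj, ite_self]
    exact continuousAt_const
  · rcases (h hj).lt_or_gt with h | h
    · refine continuousAt_const.congr (f := fun _ => β j) ?_
      filter_upwards [eventually_gt_nhds h] with t ht
      rw [switching, if_pos ht.le]
    · refine continuousAt_const.congr (f := fun _ => α j) ?_
      filter_upwards [eventually_lt_nhds h] with t ht
      rw [switching, if_neg (not_le.2 ht)]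

/-- Near each time, a switching string is one of two continuous strings whose projections agree at
that time. -/
theorem exists_continuousAt_switching (hθ : ∀ k, α k ≠ β k → (η (θ k) : ℝ) ∈ levels P k) (t₀ : I) :
    ∃ c₁ c₂ : I → ℕ → Bool, ContinuousAt c₁ t₀ ∧ ContinuousAt c₂ t₀ ∧
      (∀ t, switching α β θ t = c₁ t ∨ switching α β θ t = c₂ t) ∧
      proj P (pt P (c₁ t₀), η t₀) = proj P (pt P (switching α β θ t₀), η t₀) ∧
      proj P (pt P (c₂ t₀), η t₀) = proj P (pt P (switching α β θ t₀), η t₀) := by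
  by_cases h : ∃ k, α k ≠ β k ∧ θ k = t₀
  · obtain ⟨k, hk, rfl⟩ := h
    have hc : ∀ e : Bool, ContinuousAt
        (fun t => Function.update (switching α β θ t) k e) (θ k) := by
      intro e
      refine continuousAt_pi.2 fun j => ?_
      by_cases hj : j = k
      · subst hj
        simp only [Function.update_self]
        exact continuousAt_const
      · simp only [Function.update_of_ne hj]
        refine continuousAt_switching_apply fun hne hjk => hj ?_
        exact eq_of_mem_levels (hθ j hne) (hjk ▸ hθ k hk)
    have hp : ∀ e : Bool, proj P (pt P (Function.update (switching α β θ (θ k)) k e), η (θ k)) =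
        proj P (pt P (switching α β θ (θ k)), η (θ k)) := fun e =>
      proj_eq_of_agree (hθ k hk) fun j hj => Function.update_of_ne hj _ _
    refine ⟨_, _, hc (β k), hc (α k), fun t => ?_, hp _, hp _⟩
    by_cases ht : θ k ≤ t
    · left
      rw [eq_comm, Function.update_eq_self_iff, switching, if_pos ht]
    · right
      rw [eq_comm, Function.update_eq_self_iff, switching, if_neg ht]
  · push Not at h
    have hc : ContinuousAt (switching α β θ) t₀ :=
      continuousAt_pi.2 fun j => continuousAt_switching_apply (h j)
    exact ⟨_, _, hc, hc, fun t => Or.inl rfl, rfl, rfl⟩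

/-- The string itself may jump at `t₀`, but it alternates between two continuous branches whose
projections take the same value there. -/
theorem continuous_proj_switching (hθ : ∀ k, α k ≠ β k → (η (θ k) : ℝ) ∈ levels P k)
    (hη : Continuous η) : Continuous fun t => proj P (pt P (switching α β θ t), η t) := by
  refine continuous_iff_continuousAt.2 fun t₀ => ?_
  obtain ⟨c₁, c₂, h1, h2, hc, e1, e2⟩ := exists_continuousAt_switching hθ t₀
  have hp : ∀ c : I → ℕ → Bool, ContinuousAt c t₀ →
      ContinuousAt (fun t => proj P (pt P (c t), η t)) t₀ := fun c h =>
    (continuous_proj P).continuousAt.comp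
      (((continuous_pt P).continuousAt.comp h).prodMk hη.continuousAt)
  intro U hU
  have hU1 : ∀ᶠ t in nhds t₀, proj P (pt P (c₁ t), η t) ∈ U :=
    hp c₁ h1 (show U ∈ nhds (proj P (pt P (c₁ t₀), η t₀)) from e1 ▸ hU)
  have hU2 : ∀ᶠ t in nhds t₀, proj P (pt P (c₂ t), η t) ∈ U :=
    hp c₂ h2 (show U ∈ nhds (proj P (pt P (c₂ t₀), η t₀)) from e2 ▸ hU)
  rw [Filter.mem_map]
  filter_upwards [hU1, hU2] with t ht1 ht2
  rcases hc t with h | h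
  · simpa only [mem_preimage, h] using ht1
  · simpa only [mem_preimage, h] using ht2

/-- This lets a period of constant string be closed up at its ends while the path stays in the same
column. -/
theorem proj_switching_eq_of_mem_closure (hθ : ∀ k, α k ≠ β k → (η (θ k) : ℝ) ∈ levels P k)
    {t₀ : I} {v : ℕ → Bool} (ht : t₀ ∈ closure {t | switching α β θ t = v}) :
    proj P (pt P (switching α β θ t₀), η t₀) = proj P (pt P v, η t₀) := by
  obtain ⟨c₁, c₂, h1, h2, hc, e1, e2⟩ := exists_continuousAt_switching hθ t₀
  have hfr : ∃ᶠ t in nhds t₀, c₁ t = v ∨ c₂ t = v := by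
    refine (mem_closure_iff_frequently.1 ht).mono fun t ht => ?_
    rcases hc t with h | h
    · exact Or.inl (h ▸ ht)
    · exact Or.inr (h ▸ ht)
  have hlim : ∀ c : I → ℕ → Bool, ContinuousAt c t₀ → (∃ᶠ t in nhds t₀, c t = v) → c t₀ = v := by
    intro c hc hf
    by_contra hne
    exact hf (hc.eventually_ne hne)
  rcases Filter.frequently_or_distrib.1 hfr with h | h
  · rw [← e1, hlim c₁ h1 h]
  · rw [← e2, hlim c₂ h2 h]

theorem switching_eq_of_le {s t u : I} (hst : s ≤ t) (htu : t ≤ u)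
    (h : switching α β θ s = switching α β θ u) : switching α β θ t = switching α β θ s := by
  funext k
  have hk := congrFun h k
  unfold switching at hk ⊢
  by_cases h1 : θ k ≤ s
  · rw [if_pos h1, if_pos (h1.trans hst)]
  · rw [if_neg h1] at hk ⊢
    by_cases h2 : θ k ≤ t
    · rw [if_pos (h2.trans htu)] at hk
      rw [if_pos h2, hk]
    · rw [if_neg h2]

/-- Before `t₂` a string is given by a finite set of switched positions; from `t₂` on it is `β`. -/
theorem countable_range_switching {t₂ : I} (h2 : ∀ k, θ k ≤ t₂)
    (hfin : ∀ t < t₂, {k | α k ≠ β k ∧ θ k ≤ t}.Finite) :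
    (range (switching α β θ)).Countable := by
  classical
  refine ((countable_range fun F : Finset ℕ => fun k => if k ∈ F then β k else α k).union
    (countable_singleton β)).mono ?_
  rintro _ ⟨t, rfl⟩
  rcases lt_or_ge t t₂ with ht | ht
  · refine Or.inl ⟨(hfin t ht).toFinset, funext fun k => ?_⟩
    simp only [Finite.mem_toFinset, mem_ofPred_eq, switching]
    by_cases hk : α k = β k
    · simp [hk]
    · simp [hk]
  · exact Or.inr (funext fun k => if_pos ((h2 k).trans ht))

theorem Ioo_sInf_sSup_subset {S : Set I} (hS : S.OrdConnected) : Ioo (sInf S) (sSup S) ⊆ S := by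
  rintro t ⟨h1, h2⟩
  obtain ⟨s, hs, hst⟩ := sInf_lt_iff.1 h1
  obtain ⟨u, hu, htu⟩ := lt_sSup_iff.1 h2
  exact hS.out hs hu ⟨hst.le, htu.le⟩

theorem Icc_sInf_sSup_subset_closure {S : Set I} (hS : S.OrdConnected) (hne : S.Nonempty) :
    Icc (sInf S) (sSup S) ⊆ closure S := by
  rintro t ⟨h1, h2⟩
  rcases h1.eq_or_lt with rfl | h1
  · exact csInf_mem_closure hne (OrderBot.bddBelow S)
  rcases h2.eq_or_lt with rfl | h2
  · exact csSup_mem_closure hne (OrderTop.bddAbove S)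
  exact subset_closure (Ioo_sInf_sSup_subset hS ⟨h1, h2⟩)

/-- A path which switches digits one after another at suitable heights, in three monotone legs, is a
segment path. -/
theorem exists_segmentPath_of_switching {t₁ t₂ : I} (hη : Continuous η)
    (hθ : ∀ k, α k ≠ β k → (η (θ k) : ℝ) ∈ levels P k) (h0 : 0 < t₁)
    (h1 : ∀ k, t₁ ≤ θ k) (h2 : ∀ k, θ k ≤ t₂)
    (hfin : ∀ t < t₂, {k | α k ≠ β k ∧ θ k ≤ t}.Finite)
    (hm₀ : MonotoneOn η (Icc 0 t₁) ∨ AntitoneOn η (Icc 0 t₁))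
    (hm₁ : MonotoneOn η (Icc t₁ t₂) ∨ AntitoneOn η (Icc t₁ t₂))
    (hm₂ : MonotoneOn η (Icc t₂ 1) ∨ AntitoneOn η (Icc t₂ 1))
    {x y : Space P} (hx : proj P (pt P α, η 0) = x) (hy : proj P (pt P β, η 1) = y) :
    ∃ γ : SegmentPath x y, (∀ t, height (γ.path t) = η t) ∧
      (∀ t ≤ t₁, γ.path t = proj P (pt P α, η t)) ∧
      ∀ t, t₂ ≤ t → γ.path t = proj P (pt P β, η t) := by
  have hα : ∀ t < t₁, switching α β θ t = α := fun t ht => funext fun k =>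
    if_neg (not_le.2 (ht.trans_le (h1 k)))
  have hβ : ∀ t, t₂ ≤ t → switching α β θ t = β := fun t ht => funext fun k =>
    if_pos ((h2 k).trans ht)
  have h12 : t₁ ≤ t₂ := (h1 0).trans (h2 0)
  let p : Path x y :=
    { toFun := fun t => proj P (pt P (switching α β θ t), η t)
      continuous_toFun := continuous_proj_switching hθ hη
      source' := by rw [hα 0 h0, hx]
      target' := by rw [hβ 1 unitInterval.le_one', hy] }
  have hp : ∀ t, p t = proj P (pt P (switching α β θ t), η t) := fun t => rfl
  have hh : ∀ t, height (p t) = η t := fun t => rfl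
  let leg : I → ℕ := fun t => if t < t₁ then 0 else if t < t₂ then 1 else 2
  have hleg : Monotone leg := by
    intro s t hst
    simp only [leg]
    by_cases hs : s < t₁
    · rw [if_pos hs]
      exact Nat.zero_le _
    · have ht : ¬ t < t₁ := fun h => hs (hst.trans_lt h)
      rw [if_neg hs, if_neg ht]
      by_cases hs' : s < t₂
      · rw [if_pos hs']
        split_ifs <;> omega
      · rw [if_neg hs', if_neg fun h => hs' (hst.trans_lt h)]
  -- The segments are the closed hulls of the fibres of `g`. Recording the leg makes the height
  -- monotone on each of them.
  let g : I → ℕ × (ℕ → Bool) := fun t => (leg t, switching α β θ t)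
  have hg : (range g).Countable := by
    refine ((to_countable (univ : Set ℕ)).prod (countable_range_switching h2 hfin)).mono ?_
    rintro _ ⟨t, rfl⟩
    exact ⟨mem_univ _, t, rfl⟩
  have : Countable (range g) := hg.to_subtype
  let S : range g → Set I := fun i => g ⁻¹' {i.1}
  have hS : ∀ i, (S i).OrdConnected := by
    intro i
    refine ⟨fun s hs u hu t ht => ?_⟩
    have e1 : g s = i.1 := hs
    have e2 : g u = i.1 := hu
    have e3 : leg s = leg u := (congrArg Prod.fst e1).trans (congrArg Prod.fst e2).symm
    have e4 : leg t = leg s := le_antisymm ((hleg ht.2).trans e3.ge) (hleg ht.1)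
    have e5 : switching α β θ t = switching α β θ s := switching_eq_of_le ht.1 ht.2
      ((congrArg Prod.snd e1).trans (congrArg Prod.snd e2).symm)
    exact (Prod.ext e4 e5).trans e1
  have hSne : ∀ i, (S i).Nonempty := fun i => i.2
  have hSIcc : ∀ i, ∀ t ∈ S i, t ∈ Icc (sInf (S i)) (sSup (S i)) := fun i t ht =>
    ⟨sInf_le ht, le_sSup ht⟩
  obtain ⟨γ, hγ⟩ := exists_segmentPath_of_countable p (fun i : range g => pt P i.1.2)
    (fun i => sInf (S i)) (fun i => sSup (S i))
    (fun i => by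
      obtain ⟨t, ht⟩ := hSne i
      exact (sInf_le ht).trans (le_sSup ht))
    (fun t => ⟨⟨g t, t, rfl⟩, hSIcc _ t rfl⟩)
    (fun i j hij => by
      refine Disjoint.mono (Ioo_sInf_sSup_subset (hS i)) (Ioo_sInf_sSup_subset (hS j)) ?_
      rw [disjoint_left]
      intro t hi hj
      exact hij (Subtype.ext (Eq.trans (Eq.symm hi) hj)))
    (fun i t ht => by
      rw [hh, hp]
      refine proj_switching_eq_of_mem_closure hθ
        (closure_mono ?_ (Icc_sInf_sSup_subset_closure (hS i) (hSne i) ht))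
      exact fun s hs => congrArg Prod.snd hs)
    (fun i => by
      simp only [hh]
      have hsub : ∀ u v : I, S i ⊆ Icc u v → Icc (sInf (S i)) (sSup (S i)) ⊆ Icc u v :=
        fun u v h => Icc_subset_Icc (le_sInf fun t ht => (h ht).1) (sSup_le fun t ht => (h ht).2)
      have hor : ∀ {u v}, S i ⊆ Icc u v → MonotoneOn η (Icc u v) ∨ AntitoneOn η (Icc u v) →
          MonotoneOn η (Icc (sInf (S i)) (sSup (S i))) ∨
            AntitoneOn η (Icc (sInf (S i)) (sSup (S i))) := fun h hm =>
        hm.imp (fun h' => h'.mono (hsub _ _ h)) fun h' => h'.mono (hsub _ _ h)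
      obtain ⟨t, ht⟩ := hSne i
      have hSleg : ∀ s ∈ S i, leg s = leg t := fun s hs =>
        congrArg Prod.fst (Eq.trans hs (Eq.symm ht))
      by_cases h : t < t₁
      · refine hor (fun s hs => ⟨unitInterval.nonneg', le_of_not_gt fun hs' => ?_⟩) hm₀
        have := hSleg s hs
        simp only [leg, if_pos h, if_neg hs'.not_gt] at this
        split_ifs at this
      by_cases h' : t < t₂
      · refine hor (fun s hs => ?_) hm₁
        have := hSleg s hs
        simp only [leg, if_neg h, if_pos h'] at this
        split_ifs at this with h3 h4
        · exact ⟨not_lt.1 h3, h4.le⟩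
        · omega
      · refine hor (fun s hs => ⟨le_of_not_gt fun hs' => ?_, unitInterval.le_one'⟩) hm₂
        have := hSleg s hs
        simp only [leg, if_neg h, if_neg h', if_pos hs'] at this
        split_ifs at this
        omega)
  refine ⟨γ, fun t => by rw [hγ, hh], fun t ht => ?_, fun t ht => ?_⟩
  · rw [hγ, hp]
    -- At `t₁` itself a digit may already have switched; the claim there follows from the times just
    -- before.
    refine proj_switching_eq_of_mem_closure hθ (closure_mono (s := Iio t₁) hα ?_)
    exact (closure_Iio' (⟨0, h0⟩ : (Iio t₁).Nonempty)).ge ht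
  · rw [hγ, hp, hβ t ht]

end Switching

/-! ### The three-leg path -/

/-- A piecewise affine function with prescribed values at `0`, `1 / 3`, `2 / 3` and `1`. -/
theorem exists_piecewise_affine (u A B v : I) : ∃ η : I → I, Continuous η ∧
    (∀ t : I, (t : ℝ) ≤ 1 / 3 → (η t : ℝ) = u + (3 * t - 0) * (A - u)) ∧
    (∀ t : I, 1 / 3 ≤ (t : ℝ) → (t : ℝ) ≤ 2 / 3 → (η t : ℝ) = A + (3 * t - 1) * (B - A)) ∧
    ∀ t : I, 2 / 3 ≤ (t : ℝ) → (η t : ℝ) = B + (3 * t - 2) * (v - B) := by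
  -- A ramp from `0` to `1` over `[i / 3, (i + 1) / 3]`, constant elsewhere.
  let φ : ℝ → ℝ → ℝ := fun i t => max 0 (min 1 (3 * t - i))
  let e : ℝ → ℝ := fun t => u + φ 0 t * (A - u) + φ 1 t * (B - A) + φ 2 t * (v - B)
  have he : Continuous e := by fun_prop
  have hφ0 : ∀ i t, 3 * t ≤ i → φ i t = 0 := fun i t h =>
    max_eq_left ((min_le_right _ _).trans (by linarith))
  have hφ1 : ∀ i t, i + 1 ≤ 3 * t → φ i t = 1 := fun i t h => by
    simp only [φ]
    rw [min_eq_left (by linarith), max_eq_right zero_le_one]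
  have hφ : ∀ i t, i ≤ 3 * t → 3 * t ≤ i + 1 → φ i t = 3 * t - i := fun i t h h' => by
    simp only [φ]
    rw [min_eq_right (by linarith), max_eq_right (by linarith)]
  have hη : ∀ (t : I) (i : ℝ) (p q : I), i ≤ 3 * t → 3 * (t : ℝ) ≤ i + 1 →
      e t = p + (3 * t - i) * (q - p) →
      (projIcc (0 : ℝ) 1 zero_le_one (e t) : ℝ) = p + (3 * t - i) * (q - p) := by
    intro t i p q h1 h2 h
    have hmem : e t ∈ Icc (0 : ℝ) 1 := by
      rw [h]
      have hi : 3 * (t : ℝ) - i ∈ Icc (0 : ℝ) 1 := ⟨by linarith, by linarith⟩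
      exact (convex_Icc (0 : ℝ) 1).add_smul_sub_mem p.2 q.2 hi
    rw [projIcc_of_mem _ hmem]
    exact h
  refine ⟨fun t => projIcc 0 1 zero_le_one (e t),
    continuous_projIcc.comp (he.comp continuous_subtype_val), fun t ht => ?_, fun t ht ht' => ?_,
    fun t ht => ?_⟩
  · refine hη t 0 u A (by linarith [t.2.1]) (by linarith) ?_
    simp only [e]
    rw [hφ 0 t (by linarith [t.2.1]) (by linarith), hφ0 1 t (by linarith),
      hφ0 2 t (by linarith)]
    ring
  · refine hη t 1 A B (by linarith) (by linarith) ?_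
    simp only [e]
    rw [hφ1 0 t (by linarith), hφ 1 t (by linarith) (by linarith), hφ0 2 t (by linarith)]
    ring
  · refine hη t 2 B v (by linarith) (by linarith [t.2.2]) ?_
    simp only [e]
    rw [hφ1 0 t (by linarith), hφ1 1 t (by linarith),
      hφ 2 t (by linarith) (by linarith [t.2.2])]
    ring

theorem monotoneOn_of_affine {η : I → I} {L : Set I} {p q : I} {i : ℝ}
    (h : ∀ t ∈ L, (η t : ℝ) = p + (3 * t - i) * (q - p)) (hpq : p ≤ q) : MonotoneOn η L := by
  intro s hs t ht hst
  have h1 : (p : ℝ) ≤ q := hpq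
  have h2 : (s : ℝ) ≤ t := hst
  change (η s : ℝ) ≤ η t
  rw [h s hs, h t ht]
  nlinarith

theorem antitoneOn_of_affine {η : I → I} {L : Set I} {p q : I} {i : ℝ}
    (h : ∀ t ∈ L, (η t : ℝ) = p + (3 * t - i) * (q - p)) (hpq : q ≤ p) : AntitoneOn η L := by
  intro s hs t ht hst
  have h1 : (q : ℝ) ≤ p := hpq
  have h2 : (s : ℝ) ≤ t := hst
  change (η t : ℝ) ≤ η s
  rw [h s hs, h t ht]
  nlinarith

/-- If an interval meets the wormhole levels of an order, it contains one which is close to the end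
`B` of the interval, provided that the interval is long enough. -/
theorem exists_mem_levels_near {k : ℕ} {A B : I} (h : (uIcc (A : ℝ) B ∩ levels P k).Nonempty) :
    ∃ w ∈ levels P k, w ∈ uIcc (A : ℝ) B ∧
      (2 / (den P k : ℝ) ≤ |(B : ℝ) - A| → |w - B| ≤ 2 / (den P k : ℝ)) := by
  by_cases hk : 2 / (den P k : ℝ) ≤ |(B : ℝ) - A|
  · have h0 : (0 : ℝ) ≤ 2 / den P k := by positivity
    rcases le_total (A : ℝ) B with hAB | hAB
    · rw [abs_of_nonneg (sub_nonneg.2 hAB)] at hk ⊢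
      obtain ⟨w, hw, hw1, hw2⟩ := exists_mem_levels (P := P) (k := k)
        (u := (B : ℝ) - 2 / den P k) (v := B) (by linarith [A.2.1]) B.2.2 (by linarith)
      refine ⟨w, hw, ?_, fun _ => ?_⟩
      · rw [uIcc_of_le hAB]
        exact ⟨by linarith, hw2⟩
      · rw [abs_of_nonpos (by linarith)]
        linarith
    · rw [abs_of_nonpos (sub_nonpos.2 hAB)] at hk ⊢
      obtain ⟨w, hw, hw1, hw2⟩ := exists_mem_levels (P := P) (k := k)
        (u := (B : ℝ)) (v := (B : ℝ) + 2 / den P k) B.2.1 (by linarith [A.2.2]) (by linarith)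
      refine ⟨w, hw, ?_, fun _ => ?_⟩
      · rw [uIcc_of_ge hAB]
        exact ⟨hw1, by linarith⟩
      · rw [abs_of_nonneg (by linarith)]
        linarith
  · obtain ⟨w, hw, hw'⟩ := h
    exact ⟨w, hw', hw, fun h => absurd h hk⟩

/-- One third. -/
noncomputable def oneThird : I := ⟨1 / 3, by norm_num, by norm_num⟩

/-- Two thirds. -/
noncomputable def twoThirds : I := ⟨2 / 3, by norm_num, by norm_num⟩

/-- `A` and `B` are unordered, so that both directions of association are covered. -/
theorem exists_segmentPath_three_legs {x y : Space P} {A B : I}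
    (h : ∀ k, Required x y k → (uIcc (A : ℝ) B ∩ levels P k).Nonempty) :
    ∃ (γ : SegmentPath x y) (c c' : fractal P),
      (∀ t ∈ Icc 0 oneThird, γ.path t = proj P (c, height (γ.path t))) ∧
      (∀ t ∈ Icc twoThirds 1, γ.path t = proj P (c', height (γ.path t))) ∧
      height (γ.path oneThird) = A ∧ height (γ.path twoThirds) = B ∧
      (∀ t ∈ Icc 0 oneThird,
        (height (γ.path t) : ℝ) = height x + (3 * t - 0) * (A - height x)) ∧
      (∀ t ∈ Icc oneThird twoThirds, (height (γ.path t) : ℝ) = A + (3 * t - 1) * (B - A)) ∧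
      ∀ t ∈ Icc twoThirds 1, (height (γ.path t) : ℝ) = B + (3 * t - 2) * (height y - B) := by
  obtain ⟨α, β, hα, hβ, hreq⟩ := exists_strings x y
  obtain ⟨η, hη, hη0, hη1, hη2⟩ := exists_piecewise_affine (height x) A B (height y)
  have e1 : ((oneThird : I) : ℝ) = 1 / 3 := rfl
  have e2 : ((twoThirds : I) : ℝ) = 2 / 3 := rfl
  have hl0 : ∀ t ∈ Icc 0 oneThird, (η t : ℝ) = height x + (3 * t - 0) * (A - height x) :=
    fun t ht => hη0 t ht.2
  have hl1 : ∀ t ∈ Icc oneThird twoThirds, (η t : ℝ) = A + (3 * t - 1) * (B - A) :=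
    fun t ht => hη1 t ht.1 ht.2
  have hl2 : ∀ t ∈ Icc twoThirds 1, (η t : ℝ) = B + (3 * t - 2) * (height y - B) :=
    fun t ht => hη2 t ht.1
  -- Switching heights are taken near `B`, so that infinitely many switches can accumulate only at
  -- the end of the middle leg; this keeps the number of segments countable.
  have hsw : ∀ k, ∃ s ∈ Icc oneThird twoThirds, Required x y k → (η s : ℝ) ∈ levels P k ∧
      (2 / (den P k : ℝ) ≤ |(B : ℝ) - A| → |(η s : ℝ) - B| ≤ 2 / (den P k : ℝ)) := by
    intro k
    have h12 : oneThird ≤ twoThirds := by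
      change ((oneThird : I) : ℝ) ≤ twoThirds
      rw [e1, e2]
      norm_num
    by_cases hk : Required x y k
    · obtain ⟨w, hw, hw1, hw2⟩ := exists_mem_levels_near (h k hk)
      rw [← segment_eq_uIcc, segment_eq_image'] at hw1
      obtain ⟨r, ⟨hr0, hr1⟩, rfl⟩ := hw1
      -- The middle leg reaches height `A + r (B - A)` at time `(1 + r) / 3`.
      have hs : (⟨(1 + r) / 3, by linarith, by linarith⟩ : I) ∈ Icc oneThird twoThirds := by
        constructor
        · change ((oneThird : I) : ℝ) ≤ (1 + r) / 3
          rw [e1]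
          linarith
        · change (1 + r) / 3 ≤ ((twoThirds : I) : ℝ)
          rw [e2]
          linarith
      refine ⟨_, hs, fun _ => ?_⟩
      have e3 : (A : ℝ) + (3 * ((1 + r) / 3) - 1) * (B - A) = A + r • ((B : ℝ) - A) := by
        rw [smul_eq_mul]
        ring
      rw [hl1 _ hs, e3]
      exact ⟨hw, hw2⟩
    · exact ⟨oneThird, ⟨le_rfl, h12⟩, fun h => absurd h hk⟩
  choose θ hθ hθr using hsw
  have hmono : ∀ {L : Set I} {p q : I} {i : ℝ},
      (∀ t ∈ L, (η t : ℝ) = p + (3 * t - i) * (q - p)) → MonotoneOn η L ∨ AntitoneOn η L :=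
    fun {_ p q _} h => (le_total p q).imp (monotoneOn_of_affine h) (antitoneOn_of_affine h)
  have h03 : 0 < oneThird := by
    change (0 : ℝ) < ((oneThird : I) : ℝ)
    rw [e1]
    norm_num
  have hθl : ∀ k, α k ≠ β k → (η (θ k) : ℝ) ∈ levels P k := fun k hk => (hθr k (hreq k hk)).1
  have hfin : ∀ t < twoThirds, {k | α k ≠ β k ∧ θ k ≤ t}.Finite := by
    intro t ht
    have ht' : (t : ℝ) < 2 / 3 := ht
    by_cases hAB : (A : ℝ) = B
    · refine Set.Subsingleton.finite fun k hk l hl => ?_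
      have h1 : ∀ k, (η (θ k) : ℝ) = B := fun k => by rw [hl1 _ (hθ k), hAB]; ring
      exact eq_of_mem_levels (h1 k ▸ hθl k hk.1) (h1 l ▸ hθl l hl.1)
    · have hpos : 0 < |(B : ℝ) - A| := abs_pos.2 (sub_ne_zero.2 (Ne.symm hAB))
      obtain ⟨K, hK⟩ := exists_two_div_den_lt P
        (lt_min hpos (mul_pos (by linarith : 0 < 2 - 3 * (t : ℝ)) hpos))
      refine (finite_Iio K).subset fun k hk => mem_Iio.2 (not_le.1 fun hKk => ?_)
      have h1 := hK k hKk
      have h2 := (hθr k (hreq k hk.1)).2 (h1.le.trans (min_le_left _ _))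
      -- Up to time `t` the height stays at least `(2 - 3 t) |B - A|` away from `B`, too far for a
      -- switch of large index.
      have h3 : (η (θ k) : ℝ) - B = -((2 - 3 * (θ k : ℝ)) * ((B : ℝ) - A)) := by
        rw [hl1 _ (hθ k)]
        ring
      have h4 : ((θ k : I) : ℝ) ≤ t := hk.2
      rw [h3, abs_neg, abs_mul, abs_of_nonneg (by linarith)] at h2
      have h5 := h1.trans_le (min_le_right _ _)
      nlinarith
  have hη00 : η 0 = height x := Subtype.ext (by
    rw [hη0 0 (by norm_num)]
    norm_num)
  have hη11 : η 1 = height y := Subtype.ext (by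
    rw [hη2 1 (by norm_num)]
    norm_num)
  obtain ⟨γ, hγ, hγ0, hγ1⟩ := exists_segmentPath_of_switching (P := P) (α := α) (β := β) hη hθl
    h03 (fun k => (hθ k).1) (fun k => (hθ k).2) hfin (hmono hl0) (hmono hl1) (hmono hl2)
    (by rw [hη00, hα]) (by rw [hη11, hβ])
  refine ⟨γ, pt P α, pt P β, fun t ht => ?_, fun t ht => ?_, ?_, ?_, ?_, ?_, ?_⟩
  · rw [hγ, hγ0 t ht.2]
  · rw [hγ, hγ1 t ht.1]
  · rw [hγ]
    refine Subtype.ext ?_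
    rw [hη0 _ e1.le, e1]
    ring
  · rw [hγ]
    refine Subtype.ext ?_
    rw [hη2 _ e2.ge, e2]
    ring
  · simpa only [hγ] using hl0
  · simpa only [hγ] using hl1
  · simpa only [hγ] using hl2

theorem IsAdmissible.exists_isAssociated {x y : Space P} {a b : ℝ} (h : IsAdmissible x y a b) :
    ∃ γ : SegmentPath x y, γ.IsAssociated a b := by
  obtain ⟨ha, hab, hb, hx, hy, hk⟩ := h
  have h12 : oneThird ≤ twoThirds := by
    change (1 / 3 : ℝ) ≤ 2 / 3
    norm_num
  rcases le_total (height x) (height y) with hxy | hxy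
  · obtain ⟨γ, c, c', hc, hc', e1, e2, l0, l1, l2⟩ := exists_segmentPath_three_legs
      (A := ⟨a, ha, hab.trans hb⟩) (B := ⟨b, ha.trans hab, hb⟩) (x := x) (y := y)
      (fun k hk' => by rw [uIcc_of_le hab]; exact hk k hk')
    exact ⟨γ, oneThird, twoThirds, h12, ⟨c, hc⟩, ⟨c', hc'⟩, Or.inl ⟨hxy,
      antitoneOn_of_affine l0 hx.1, congrArg Subtype.val e1, monotoneOn_of_affine l1 hab,
      congrArg Subtype.val e2, antitoneOn_of_affine l2 hy.2⟩⟩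
  · obtain ⟨γ, c, c', hc, hc', e1, e2, l0, l1, l2⟩ := exists_segmentPath_three_legs
      (A := ⟨b, ha.trans hab, hb⟩) (B := ⟨a, ha, hab.trans hb⟩) (x := x) (y := y)
      (fun k hk' => by rw [uIcc_of_ge hab]; exact hk k hk')
    exact ⟨γ, oneThird, twoThirds, h12, ⟨c, hc⟩, ⟨c', hc'⟩, Or.inr ⟨hxy,
      monotoneOn_of_affine l0 hx.2, congrArg Subtype.val e1, antitoneOn_of_affine l1 hab,
      congrArg Subtype.val e2, monotoneOn_of_affine l2 hy.1⟩⟩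

end Laakso

theorem mainTheorem1 (P : Laakso.Params) (x y : Laakso.Space P) :
    (∃ a b : ℝ, Laakso.IsMinimalInterval x y a b) ∧
    ∀ a b : ℝ, Laakso.IsMinimalInterval x y a b →
      (∃ γ : Laakso.SegmentPath x y, γ.IsAssociated a b) ∧
      (∀ γ : Laakso.SegmentPath x y, γ.IsAssociated a b → γ.IsGeodesic) ∧
      Laakso.laaksoDist x y =
        ENNReal.ofReal (2 * b - 2 * a - |(Laakso.height y : ℝ) - (Laakso.height x : ℝ)|) := by
  refine ⟨Laakso.exists_isMinimalInterval x y, fun a b h => ?_⟩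
  obtain ⟨γ₀, hγ₀⟩ := h.1.exists_isAssociated
  exact ⟨⟨γ₀, hγ₀⟩,
    fun γ hγ => le_antisymm ((γ.length_le_of_isAssociated hγ).trans h.le_laaksoDist)
      γ.laaksoDist_le_length,
    le_antisymm (γ₀.laaksoDist_le_length.trans (γ₀.length_le_of_isAssociated hγ₀))
      h.le_laaksoDist⟩
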